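/- Let $n\ge 2$ and let $P(z)=z^n+a_1z^{n-1}+a_2z^{n-2}+\dots+a_n$ be a monic polynomial of degree $n$ with complex coefficients. For $t\in\mathbb{R}$ let $E_P(t)=\{z\in\mathbb{C}:\ln|P(z)|=t\}$ and let $|E_P(t)|$ denote its length (one-dimensional Hausdorff measure). Put $T(P)=\max\{\ln|P(\zeta)| : \zeta\in\mathbb{C},\ P'(\zeta)=0\}\in[-\infty,\infty)$, where $\ln 0=-\infty$. Then for every real $t\ge T(P)$ $$e^{4t/n}\left(\frac{e^{-t/n}}{2\pi}\,|E_P(t)|-1\right)\ \ge\ \left|\frac{(n-1)a_1^2-2na_2}{4n^2}\right|^2 .$$ The estimate is sharp: for every such $P$ the left-hand side tends to the right-hand side as $t\to+\infty$. -/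

import Mathlib

open Filter Topology MeasureTheory Polynomial

noncomputable section

namespace Lemniscate

/-- `ln |P(z)|` as an extended real number, equal to `-∞` exactly at the zeros of `P`. -/
def logAbs (P : ℂ[X]) (z : ℂ) : EReal :=
  ENNReal.log ‖P.eval z‖ₑ

/-- The lemniscate `E_P(t) = {z : ln |P(z)| = t}`. -/
def level (P : ℂ[X]) (t : ℝ) : Set ℂ :=
  {z | logAbs P z = (t : EReal)}

/-- The length `|E_P(t)|`, that is, the one-dimensional Hausdorff measure of the lemniscate. -/
def length (P : ℂ[X]) (t : ℝ) : ℝ :=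
  (Measure.hausdorffMeasure 1 (level P t)).toReal

/-- The largest critical value `T(P) = max {ln |P(ζ)| : P'(ζ) = 0}`, an extended real number
(it is `-∞` when `P` vanishes at all of its critical points). -/
def maxCriticalValue (P : ℂ[X]) : EReal :=
  ⨆ ζ ∈ {ζ : ℂ | (derivative P).eval ζ = 0}, logAbs P ζ

end Lemniscate

end

/-! Let `ψ` be the inverse near infinity of the `n`-th root of `P`. With `u = 1 / w` and `k u = u *
ψ (1 / u)`, the equation `P (ψ w) = w ^ n` becomes `homog P u (k u) = 1`, which is regular at `u =
0`. Above the critical levels `E_P(t)` is the image under `ψ` of the circle `‖u‖ = r`, where `r =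
exp (-t / n)`, so `r / (2π)` times its length is the mean of `‖ψ'‖` over that circle
(`IsBranch.hausdorffMeasure_eq`).

As a function of `u`, `ψ'` is holomorphic without zeros on the disc, and its expansion `1 + c u ^ 2
+ ⋯` has no linear term (`IsBranch.speed_eq`, `IsBranch.hasJet_speed`). Hence it has a square root
`1 + u ^ 2 * K u` with `K 0 = c / 2`, and the mean of `‖1 + u ^ 2 * K u‖ ^ 2` is exactly `1 + r ^ 4`
times the mean of `‖K‖ ^ 2` (`exists_circleAverage_norm_eq`). The mean of `‖K‖ ^ 2` is at least `‖K
0‖ ^ 2` and tends to it as `r → 0`, which gives both the inequality and its sharpness.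

At `t = T(P)` critical points may lie on the lemniscate and `ψ'` may be unbounded. The branch is
therefore built on a star-shaped domain that contains the closed disc except for countably many
boundary points. A Łojasiewicz inequality supplies an integrable majorant of `‖ψ'‖`, uniform in the
radius, and the estimate passes to the critical circle by dominated convergence. -/

namespace Lemniscate

open scoped ENNReal NNReal

/-! ### Homogenization of `P` -/

/-- The homogenization `u ^ n * P (y / u)` of a polynomial `P` of degree `n`. -/
noncomputable def homog (P : ℂ[X]) (u y : ℂ) : ℂ := (P.scaleRoots u).eval y

/-- The derivative of the homogenization `homog P u y` in the variable `y`. -/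
noncomputable def homogDeriv (P : ℂ[X]) (u y : ℂ) : ℂ := (derivative (P.scaleRoots u)).eval y

theorem homog_eq_sum (P : ℂ[X]) (u y : ℂ) :
    homog P u y = ∑ i ∈ Finset.range (P.natDegree + 1),
      P.coeff i * u ^ (P.natDegree - i) * y ^ i := by
  simp [homog, eval_eq_sum_range, natDegree_scaleRoots, coeff_scaleRoots]

theorem homog_mul_right (P : ℂ[X]) (u z : ℂ) :
    homog P u (u * z) = u ^ P.natDegree * P.eval z :=
  scaleRoots_eval_mul P z u

theorem homog_mul_mul (P : ℂ[X]) (c u y : ℂ) :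
    homog P (c * u) (c * y) = c ^ P.natDegree * homog P u y := by
  rw [homog_eq_sum, homog_eq_sum, Finset.mul_sum]
  refine Finset.sum_congr rfl fun i hi => ?_
  have hi' : i ≤ P.natDegree := Nat.lt_succ_iff.mp (Finset.mem_range.mp hi)
  rw [mul_pow, mul_pow, ← Nat.sub_add_cancel hi', pow_add c, Nat.add_sub_cancel]
  ring

theorem homog_zero_left {P : ℂ[X]} (hP : P.Monic) (y : ℂ) :
    homog P 0 y = y ^ P.natDegree := by
  simp [homog, hP.leadingCoeff]

theorem homogDeriv_zero_left {P : ℂ[X]} (hP : P.Monic) (y : ℂ) :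
    homogDeriv P 0 y = P.natDegree * y ^ (P.natDegree - 1) := by
  simp [homogDeriv, hP.leadingCoeff, derivative_X_pow]

theorem hasDerivAt_homog (P : ℂ[X]) (u y : ℂ) :
    HasDerivAt (homog P u) (homogDeriv P u y) y :=
  (P.scaleRoots u).hasDerivAt y

theorem homogDeriv_mul_right {P : ℂ[X]} (hn : P.natDegree ≠ 0) {u : ℂ} (hu : u ≠ 0) (z : ℂ) :
    homogDeriv P u (u * z) = u ^ (P.natDegree - 1) * (derivative P).eval z := by
  have h1 : HasDerivAt (fun z => homog P u (u * z)) (homogDeriv P u (u * z) * u) z :=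
    (hasDerivAt_homog P u (u * z)).comp z (by simpa using (hasDerivAt_id z).const_mul u)
  have h2 : HasDerivAt (fun z => homog P u (u * z))
      (u ^ P.natDegree * (derivative P).eval z) z := by
    simp_rw [homog_mul_right]
    exact (P.hasDerivAt z).const_mul _
  have h3 := h1.unique h2
  obtain ⟨m, hm⟩ := Nat.exists_eq_succ_of_ne_zero hn
  rw [hm] at h3 ⊢
  apply mul_right_cancel₀ hu
  rw [h3, Nat.succ_eq_add_one, Nat.add_sub_cancel, pow_succ]
  ring

theorem contDiff_homog (P : ℂ[X]) : ContDiff ℂ 1 fun p : ℂ × ℂ => homog P p.1 p.2 := by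
  simp_rw [homog_eq_sum]
  fun_prop

theorem continuous_homogDeriv (P : ℂ[X]) : Continuous fun p : ℂ × ℂ => homogDeriv P p.1 p.2 := by
  simp only [homogDeriv, derivative_eval]
  have : ∀ p : ℂ × ℂ, ((P.scaleRoots p.1).sum fun m a => a * m * p.2 ^ (m - 1)) =
      ∑ i ∈ Finset.range (P.natDegree + 1),
        P.coeff i * p.1 ^ (P.natDegree - i) * i * p.2 ^ (i - 1) := by
    intro p
    rw [sum_over_range _ (by simp), natDegree_scaleRoots]
    simp [coeff_scaleRoots]
  simp_rw [this]
  fun_prop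

/-! ### A star-shaped domain over which the roots stay simple -/

/-- The set of `u` such that `u ^ n * P ζ` avoids `[1, ∞)` for every critical point `ζ` of `P`. -/
def starDomain (P : ℂ[X]) : Set ℂ :=
  {u | ∀ ζ, (derivative P).eval ζ = 0 → 1 - u ^ P.natDegree * P.eval ζ ∈ Complex.slitPlane}

theorem finite_criticalPoints {P : ℂ[X]} (hn : P.natDegree ≠ 0) :
    {ζ : ℂ | (derivative P).eval ζ = 0}.Finite := by
  have h : derivative P ≠ 0 := fun h => hn (derivative_eq_zero.mp h)
  exact (derivative P).finite_setOfPred_isRoot h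

theorem isOpen_starDomain {P : ℂ[X]} (hn : P.natDegree ≠ 0) : IsOpen (starDomain P) := by
  have : starDomain P = ⋂ ζ ∈ {ζ : ℂ | (derivative P).eval ζ = 0},
      (fun u : ℂ => 1 - u ^ P.natDegree * P.eval ζ) ⁻¹' Complex.slitPlane := by
    ext u; simp [starDomain]
  rw [this]
  exact (finite_criticalPoints hn).isOpen_biInter fun ζ _ =>
    Complex.isOpen_slitPlane.preimage (by fun_prop)

theorem zero_mem_starDomain {P : ℂ[X]} (hn : P.natDegree ≠ 0) : (0 : ℂ) ∈ starDomain P := by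
  intro ζ _
  simp [hn]

theorem starConvex_starDomain {P : ℂ[X]} (hn : P.natDegree ≠ 0) :
    StarConvex ℝ 0 (starDomain P) := by
  rw [starConvex_iff_forall_pos (zero_mem_starDomain hn)]
  intro u hu a b ha hb hab ζ hζ
  have hb1 : b ≤ 1 := by linarith
  have h := starConvex_iff_segment_subset.mp Complex.starConvex_one_slitPlane (hu ζ hζ)
  -- Moving `u` to `b * u` moves `1 - u ^ n * P ζ` along the segment towards `1`, with weight `b ^
  -- n`, and the slit plane is star-shaped about `1`.
  refine h ⟨1 - b ^ P.natDegree, b ^ P.natDegree, ?_, by positivity, by ring, ?_⟩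
  · have := pow_le_one₀ hb.le hb1 (n := P.natDegree)
    linarith
  · simp only [smul_zero, zero_add, Complex.real_smul]
    push_cast
    ring

theorem mul_mem_starDomain {P : ℂ[X]} {c u : ℂ} (hc : c ^ P.natDegree = 1)
    (hu : u ∈ starDomain P) : c * u ∈ starDomain P := by
  intro ζ hζ
  simpa [mul_pow, hc] using hu ζ hζ

/-- For `u ≠ 0` a multiple root would be `y = u * ζ` with `ζ` critical and `u ^ n * P ζ = 1`, which
the domain excludes. For `u = 0` the equation is `y ^ n = 1`. -/
theorem homogDeriv_ne_zero {P : ℂ[X]} (hP : P.Monic) (hn : P.natDegree ≠ 0) {u y : ℂ}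
    (hu : u ∈ starDomain P) (h : homog P u y = 1) : homogDeriv P u y ≠ 0 := by
  by_cases hu0 : u = 0
  · subst hu0
    rw [homog_zero_left hP] at h
    rw [homogDeriv_zero_left hP]
    have hy : y ≠ 0 := by
      rintro rfl
      simp [hn] at h
    exact mul_ne_zero (Nat.cast_ne_zero.mpr hn) (pow_ne_zero _ hy)
  · obtain ⟨z, rfl⟩ : ∃ z, y = u * z := ⟨y / u, by field_simp⟩
    rw [homog_mul_right] at h
    rw [homogDeriv_mul_right hn hu0]
    refine mul_ne_zero (pow_ne_zero _ hu0) fun hz => ?_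
    have := hu z hz
    simp [h] at this

/-! ### Covering property and global branches -/

/-- The map `(u, y) ↦ (u, homog P u y)`. -/
noncomputable def homogMap (P : ℂ[X]) (p : ℂ × ℂ) : ℂ × ℂ := (p.1, homog P p.1 p.2)

theorem contDiff_homogMap (P : ℂ[X]) : ContDiff ℂ 1 (homogMap P) :=
  contDiff_fst.prodMk (contDiff_homog P)

/-- The differential is block triangular with diagonal entries `1` and `homogDeriv`, hence
invertible. -/
theorem exists_hasStrictFDerivAt_homogMap (P : ℂ[X]) {p : ℂ × ℂ}
    (h : homogDeriv P p.1 p.2 ≠ 0) :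
    ∃ e : (ℂ × ℂ) ≃L[ℂ] (ℂ × ℂ),
      HasStrictFDerivAt (homogMap P) (e : (ℂ × ℂ) →L[ℂ] (ℂ × ℂ)) p := by
  have h1 : HasStrictFDerivAt (fun p : ℂ × ℂ => homog P p.1 p.2)
      (fderiv ℂ (fun p : ℂ × ℂ => homog P p.1 p.2) p) p :=
    ((contDiff_homog P).contDiffAt).hasStrictFDerivAt one_ne_zero
  set D := fderiv ℂ (fun p : ℂ × ℂ => homog P p.1 p.2) p
  have h2 : HasStrictFDerivAt (homogMap P) ((ContinuousLinearMap.fst ℂ ℂ ℂ).prod D) p :=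
    hasStrictFDerivAt_fst.prodMk h1
  have hD : D (0, 1) = homogDeriv P p.1 p.2 := by
    have h3 : HasDerivAt (fun y : ℂ => ((p.1, y) : ℂ × ℂ)) (0, 1) p.2 :=
      (hasDerivAt_const _ _).prodMk (hasDerivAt_id _)
    have h4 := (HasFDerivAt.comp_hasDerivAt (x := p.2) (f := fun y : ℂ => ((p.1, y) : ℂ × ℂ))
      (hl := h1.hasFDerivAt) (hf := h3))
    exact h4.unique (hasDerivAt_homog P p.1 p.2)
  have hinj : Function.Injective ((ContinuousLinearMap.fst ℂ ℂ ℂ).prod D) := by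
    rw [injective_iff_map_eq_zero]
    rintro ⟨a, b⟩ hab
    simp only [ContinuousLinearMap.prod_apply, ContinuousLinearMap.coe_fst',
      Prod.mk_eq_zero] at hab
    obtain ⟨rfl, hb⟩ := hab
    have : ((0 : ℂ), b) = b • ((0 : ℂ), (1 : ℂ)) := by simp
    rw [this, map_smul, hD, smul_eq_mul] at hb
    simpa [h] using hb
  refine ⟨(LinearEquiv.ofInjectiveEndo (((ContinuousLinearMap.fst ℂ ℂ ℂ).prod D :
    (ℂ × ℂ) →L[ℂ] (ℂ × ℂ)) : (ℂ × ℂ) →ₗ[ℂ] (ℂ × ℂ)) hinj).toContinuousLinearEquiv, ?_⟩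
  convert h2
  ext <;> rfl

/-- A Cauchy-type root bound, locally uniform in `(u, w)`; it is what makes `homogMap` proper. -/
theorem norm_le_of_homog {P : ℂ[X]} (hP : P.Monic) (hn : P.natDegree ≠ 0) {u y w : ℂ}
    (h : homog P u y = w) :
    ‖y‖ ≤ 1 + ‖w‖ + ∑ i ∈ Finset.range P.natDegree,
      ‖P.coeff i‖ * ‖u‖ ^ (P.natDegree - i) := by
  by_cases hy : ‖y‖ ≤ 1
  · have : 0 ≤ ∑ i ∈ Finset.range P.natDegree, ‖P.coeff i‖ * ‖u‖ ^ (P.natDegree - i) := by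
      positivity
    have := norm_nonneg w
    linarith
  push Not at hy
  have hpos : 0 < P.natDegree := Nat.pos_of_ne_zero hn
  set N := P.natDegree with hN
  have h1 : y ^ N = w - ∑ i ∈ Finset.range N, P.coeff i * u ^ (N - i) * y ^ i := by
    rw [homog_eq_sum, Finset.sum_range_succ, ← hN, hN, hP.coeff_natDegree] at h
    rw [← h, ← hN]; simp
  have h2 : ‖y‖ ^ N ≤ (‖w‖ + ∑ i ∈ Finset.range N, ‖P.coeff i‖ * ‖u‖ ^ (N - i)) *
      ‖y‖ ^ (N - 1) := by
    rw [← norm_pow, h1]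
    refine (norm_sub_le _ _).trans ?_
    rw [add_mul, Finset.sum_mul]
    refine add_le_add (le_mul_of_one_le_right (norm_nonneg _) (one_le_pow₀ hy.le))
      ((norm_sum_le _ _).trans (Finset.sum_le_sum fun i hi => ?_))
    rw [norm_mul, norm_mul, norm_pow, norm_pow]
    have := Finset.mem_range.mp hi
    gcongr
    · exact hy.le
    · omega
  have h3 : ‖y‖ ^ N = ‖y‖ * ‖y‖ ^ (N - 1) := by
    rw [← pow_succ', Nat.sub_add_cancel hpos]
  rw [h3] at h2
  have := le_of_mul_le_mul_right h2 (by positivity)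
  linarith

theorem isProperMap_homogMap {P : ℂ[X]} (hP : P.Monic) (hn : P.natDegree ≠ 0) :
    IsProperMap (homogMap P) := by
  have hc : Continuous (homogMap P) := (contDiff_homogMap P).continuous
  rw [isProperMap_iff_isCompact_preimage]
  refine ⟨hc, fun K hK => Metric.isCompact_of_isClosed_isBounded
    (hK.isClosed.preimage hc) ?_⟩
  let b : ℂ × ℂ → ℝ := fun q => 1 + ‖q.2‖ + ∑ i ∈ Finset.range P.natDegree,
      ‖P.coeff i‖ * ‖q.1‖ ^ (P.natDegree - i)
  have hb : Continuous b := by fun_prop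
  obtain ⟨A, hA⟩ := hK.bddAbove_image hb.continuousOn
  obtain ⟨B, hB⟩ := hK.bddAbove_image (f := fun q : ℂ × ℂ => ‖q.1‖) (by fun_prop)
  refine isBounded_iff_forall_norm_le.mpr ⟨max A B, fun p hp => ?_⟩
  rw [Prod.norm_def, max_comm A B]
  exact max_le_max (hB ⟨_, hp, rfl⟩)
    ((norm_le_of_homog hP hn (u := p.1) (y := p.2) rfl).trans (hA ⟨_, hp, rfl⟩))

/-- A closed map with finite fibres is a covering over points where it is a local homeomorphism.
Simplicity of the roots gives this over the slice with second coordinate `1`, which is enough to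
lift sections of the star domain. -/
theorem isCoveringMapOn_homogMap {P : ℂ[X]} (hP : P.Monic) (hn : P.natDegree ≠ 0) :
    IsCoveringMapOn (homogMap P) {q | q.1 ∈ starDomain P ∧ q.2 = 1} := by
  refine (isProperMap_homogMap hP hn).isClosedMap.isCoveringMapOn_of_isLocalHomeomorphOn ?_ ?_
  · rintro ⟨u, w⟩ -
    have h1 : P.scaleRoots u - C w ≠ 0 := by
      intro h
      have h2 := congrArg natDegree h
      rw [natDegree_sub_C, natDegree_scaleRoots] at h2
      exact hn (by simpa using h2)
    refine Set.Finite.subset (((P.scaleRoots u - C w).finite_setOfPred_isRoot h1).image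
      fun y => (u, y)) ?_
    rintro ⟨u', y⟩ h
    simp only [Set.mem_preimage, homogMap, Set.mem_singleton_iff, Prod.mk.injEq] at h
    obtain ⟨rfl, h⟩ := h
    exact ⟨y, by simpa [IsRoot, sub_eq_zero, homog] using h, rfl⟩
  · rintro p ⟨hp1, hp2⟩
    obtain ⟨e, he⟩ := exists_hasStrictFDerivAt_homogMap P (p := p)
      (homogDeriv_ne_zero hP hn hp1 hp2)
    exact ⟨_, he.mem_toOpenPartialHomeomorph_source, by simp⟩

/-- Every root of `homog P u₀ = 1` extends to a continuous branch over the star domain. -/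
theorem exists_branch {P : ℂ[X]} (hP : P.Monic) (hn : P.natDegree ≠ 0) {u₀ y₀ : ℂ}
    (hu₀ : u₀ ∈ starDomain P) (h₀ : homog P u₀ y₀ = 1) :
    ∃ k : ℂ → ℂ, ContinuousOn k (starDomain P) ∧ k u₀ = y₀ ∧
      ∀ u ∈ starDomain P, homog P u (k u) = 1 := by
  have hc : ContractibleSpace (starDomain P) :=
    (starConvex_starDomain hn).contractibleSpace ⟨0, zero_mem_starDomain hn⟩
  have hl : LocallyPathConnectedSpace (starDomain P) :=
    (isOpen_starDomain hn).locallyPathConnectedSpace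
  let f : C(starDomain P, ℂ × ℂ) := ⟨fun u => (u, 1), by fun_prop⟩
  obtain ⟨F, ⟨hF0, hF⟩, -⟩ := (isCoveringMapOn_homogMap hP hn).existsUnique_continuousMap_lifts f
    (a₀ := ⟨u₀, hu₀⟩) (e₀ := (u₀, y₀)) (by simp [homogMap, f, h₀]) (fun a => ⟨a.2, rfl⟩)
  have hF' : ∀ a, (F a).1 = a ∧ homog P (F a).1 (F a).2 = 1 := fun a => by
    simpa [homogMap, f, Prod.ext_iff] using congrFun hF a
  classical
  refine ⟨fun u => if hu : u ∈ starDomain P then (F ⟨u, hu⟩).2 else 0, ?_, ?_, ?_⟩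
  · rw [continuousOn_iff_continuous_domRestrict]
    have : (starDomain P).domRestrict
        (fun u => if hu : u ∈ starDomain P then (F ⟨u, hu⟩).2 else 0) =
        fun a => (F a).2 := by
      ext a; simp
    rw [this]
    fun_prop
  · simp [hu₀, hF0]
  · intro u hu
    have := hF' ⟨u, hu⟩
    rw [this.1] at this
    simpa [hu] using this.2

/-- Uniqueness of lifts through a covering, the base being contractible. -/
theorem eqOn_of_branch {P : ℂ[X]} (hP : P.Monic) (hn : P.natDegree ≠ 0) {k₁ k₂ : ℂ → ℂ}
    (hk₁ : ContinuousOn k₁ (starDomain P)) (hk₂ : ContinuousOn k₂ (starDomain P))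
    (h₁ : ∀ u ∈ starDomain P, homog P u (k₁ u) = 1)
    (h₂ : ∀ u ∈ starDomain P, homog P u (k₂ u) = 1) {u₀ : ℂ} (hu₀ : u₀ ∈ starDomain P)
    (h : k₁ u₀ = k₂ u₀) : Set.EqOn k₁ k₂ (starDomain P) := by
  have hc : ContractibleSpace (starDomain P) :=
    (starConvex_starDomain hn).contractibleSpace ⟨0, zero_mem_starDomain hn⟩
  have hl : LocallyPathConnectedSpace (starDomain P) :=
    (isOpen_starDomain hn).locallyPathConnectedSpace
  let f : C(starDomain P, ℂ × ℂ) := ⟨fun u => (u, 1), by fun_prop⟩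
  have hu := (isCoveringMapOn_homogMap hP hn).existsUnique_continuousMap_lifts f
    (a₀ := ⟨u₀, hu₀⟩) (e₀ := (u₀, k₁ u₀)) (by simp [homogMap, f, h₁ u₀ hu₀]) (fun a => ⟨a.2, rfl⟩)
  rw [continuousOn_iff_continuous_domRestrict] at hk₁ hk₂
  let F₁ : C(starDomain P, ℂ × ℂ) := ⟨fun u => (u, k₁ u), continuous_subtype_val.prodMk hk₁⟩
  let F₂ : C(starDomain P, ℂ × ℂ) := ⟨fun u => (u, k₂ u), continuous_subtype_val.prodMk hk₂⟩
  have hF := hu.unique (y₁ := F₁) (y₂ := F₂)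
    ⟨rfl, funext fun a => by simp [homogMap, F₁, f, h₁ a a.2]⟩
    ⟨by simp [F₂, h], funext fun a => by simp [homogMap, F₂, f, h₂ a a.2]⟩
  intro u hu
  simpa [F₁, F₂] using congrArg Prod.snd (DFunLike.congr_fun hF ⟨u, hu⟩)

theorem differentiableOn_branch {P : ℂ[X]} (hP : P.Monic) (hn : P.natDegree ≠ 0) {k : ℂ → ℂ}
    (hk : ContinuousOn k (starDomain P)) (h : ∀ u ∈ starDomain P, homog P u (k u) = 1) :
    DifferentiableOn ℂ k (starDomain P) := by
  intro u hu
  have hnhds := (isOpen_starDomain hn).mem_nhds hu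
  obtain ⟨e, he⟩ := exists_hasStrictFDerivAt_homogMap P (p := (u, k u))
      (homogDeriv_ne_zero hP hn hu (h u hu))
  have hloc : HasFDerivAt (he.localInverse _ _ _) (e.symm : (ℂ × ℂ) →L[ℂ] (ℂ × ℂ)) (u, 1) := by
    have := he.to_localInverse.hasFDerivAt
    simpa [homogMap, h u hu] using this
  have hkc : ContinuousAt (fun v => (v, k v)) u := continuousAt_id.prodMk (hk.continuousAt hnhds)
  -- By continuity the graph of `k` stays in the region where the local inverse of `homogMap` is a
  -- left inverse.
  have hev : (fun v => (v, k v)) =ᶠ[𝓝 u] fun v => he.localInverse _ _ _ (v, 1) := by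
    filter_upwards [hkc.eventually he.eventually_left_inverse, hnhds] with v hv hvm
    rw [← hv]
    simp [homogMap, h v hvm]
  have hd : DifferentiableAt ℂ (fun v => he.localInverse _ _ _ (v, (1 : ℂ))) u :=
    DifferentiableAt.comp (g := he.localInverse _ _ _) u hloc.differentiableAt (by fun_prop)
  have := (hd.congr_of_eventuallyEq hev).snd
  exact this.differentiableWithinAt

/-! ### Length of regular curves -/

theorem hausdorffMeasure_le_image_of_dist_le {X Y : Type*} [MetricSpace X] [MeasurableSpace X]
    [BorelSpace X] [MetricSpace Y] [MeasurableSpace Y] [BorelSpace Y] {f : X → Y} {A : Set X}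
    {K : ℝ≥0} {d : ℝ} (hd : 0 ≤ d)
    (h : ∀ x ∈ A, ∀ y ∈ A, dist x y ≤ K * dist (f x) (f y)) :
    Measure.hausdorffMeasure d A ≤ (K : ℝ≥0∞) ^ d * Measure.hausdorffMeasure d (f '' A) := by
  rcases A.eq_empty_or_nonempty with rfl | ⟨a, -⟩
  · simp
  have : Nonempty X := ⟨a⟩
  have hinj : Set.InjOn f A := fun x hx y hy hxy => by
    have := h x hx y hy
    rw [hxy, dist_self, mul_zero] at this
    exact dist_le_zero.mp this
  have hl : LipschitzOnWith K (Function.invFunOn f A) (f '' A) := by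
    refine LipschitzOnWith.of_dist_le_mul ?_
    rintro _ ⟨x, hx, rfl⟩ _ ⟨y, hy, rfl⟩
    rw [hinj.leftInvOn_invFunOn hx, hinj.leftInvOn_invFunOn hy]
    exact h x hx y hy
  have := hl.hausdorffMeasure_image_le hd
  rwa [hinj.leftInvOn_invFunOn.image_image] at this

/-- Near a regular point the length of an image and the integral of the speed are comparable. -/
theorem exists_nhds_hausdorffMeasure_image_comparable {γ γ' : ℝ → ℂ} {S : Set ℝ} {x₀ : ℝ}
    (hd : HasStrictDerivAt γ (γ' x₀) x₀) (hc : ContinuousWithinAt γ' S x₀) (hne : γ' x₀ ≠ 0)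
    {c : ℝ} (hc1 : 1 < c) :
    ∃ V ∈ 𝓝[S] x₀, ∀ A ⊆ V, MeasurableSet A →
      Measure.hausdorffMeasure 1 (γ '' A) ≤ ENNReal.ofReal c * ∫⁻ x in A, ‖γ' x‖ₑ ∧
      ∫⁻ x in A, ‖γ' x‖ₑ ≤ ENNReal.ofReal c * Measure.hausdorffMeasure 1 (γ '' A) := by
  set m := ‖γ' x₀‖ with hm
  have hm0 : 0 < m := norm_pos_iff.mpr hne
  -- Chosen so that `m + ε = c * (m - ε)`: both the speed and the distortion of distances lie
  -- between `m - ε` and `m + ε`.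
  set ε := m * (c - 1) / (c + 1) with hε
  have hε0 : 0 < ε := by
    have : 0 < c - 1 := by linarith
    positivity
  have hlo : m - ε = m * 2 / (c + 1) := by rw [hε]; field_simp; ring
  have hhi : m + ε = c * (m - ε) := by rw [hlo, hε]; field_simp; ring
  have hlo0 : 0 < m - ε := by rw [hlo]; positivity
  have h1 : ∀ᶠ p in 𝓝 (x₀, x₀),
      ‖γ p.1 - γ p.2 - (p.1 - p.2) • γ' x₀‖ ≤ ε * ‖p.1 - p.2‖ := by
    have := (hasStrictFDerivAt_iff_isLittleO.mp hd.hasStrictFDerivAt).def hε0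
    simpa using this
  rw [nhds_prod_eq] at h1
  obtain ⟨W, hW, hWp⟩ := (Filter.eventually_prod_self_iff (r := fun x y =>
    ‖γ x - γ y - (x - y) • γ' x₀‖ ≤ ε * ‖x - y‖)).mp h1
  have h2 : ∀ᶠ x in 𝓝[S] x₀, ‖γ' x - γ' x₀‖ < ε := by
    simpa [dist_eq_norm] using Metric.tendsto_nhds.mp hc ε hε0
  refine ⟨W ∩ {x | ‖γ' x - γ' x₀‖ < ε}, inter_mem (mem_nhdsWithin_of_mem_nhds hW) h2,
    fun A hA hAm => ?_⟩
  have hest : ∀ x ∈ A, ∀ y ∈ A, |dist (γ x) (γ y) - m * dist x y| ≤ ε * dist x y := by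
    intro x hx y hy
    have h3 := hWp x (hA hx).1 y (hA hy).1
    have h4 : ‖(x - y) • γ' x₀‖ = m * dist x y := by
      rw [norm_smul, dist_eq_norm, mul_comm]
    rw [← h4, dist_eq_norm, dist_eq_norm x y]
    exact (abs_norm_sub_norm_le _ _).trans h3
  have hvol : Measure.hausdorffMeasure 1 A = volume A := by rw [hausdorffMeasure_real]
  have hsp : ∀ x ∈ A, m - ε ≤ ‖γ' x‖ ∧ ‖γ' x‖ ≤ m + ε := by
    intro x hx
    have h3 : ‖γ' x - γ' x₀‖ < ε := (hA hx).2
    have h4 := abs_le.mp ((abs_norm_sub_norm_le (γ' x) (γ' x₀)).trans h3.le)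
    constructor <;> linarith [h4.1, h4.2]
  have b1 : Measure.hausdorffMeasure 1 (γ '' A) ≤ ENNReal.ofReal (m + ε) * volume A := by
    have hl : LipschitzOnWith (Real.toNNReal (m + ε)) γ A := by
      refine LipschitzOnWith.of_dist_le_mul fun x hx y hy => ?_
      rw [Real.coe_toNNReal _ (by positivity)]
      linarith [(abs_le.mp (hest x hx y hy)).2]
    simpa [hvol, ENNReal.ofReal] using hl.hausdorffMeasure_image_le (d := 1) zero_le_one
  have b2 : ENNReal.ofReal (m - ε) * volume A ≤ Measure.hausdorffMeasure 1 (γ '' A) := by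
    have h3 := hausdorffMeasure_le_image_of_dist_le (f := γ) (A := A)
      (K := (Real.toNNReal (m - ε))⁻¹) (d := 1) zero_le_one fun x hx y hy => by
        rw [NNReal.coe_inv, Real.coe_toNNReal _ hlo0.le, inv_mul_eq_div, le_div_iff₀ hlo0]
        linarith [(abs_le.mp (hest x hx y hy)).1]
    have h0 : Real.toNNReal (m - ε) ≠ 0 := by simpa using hlo0
    rw [hvol, ENNReal.rpow_one, ENNReal.coe_inv h0] at h3
    calc ENNReal.ofReal (m - ε) * volume A
        ≤ ENNReal.ofReal (m - ε) * ((ENNReal.ofReal (m - ε))⁻¹ *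
            Measure.hausdorffMeasure 1 (γ '' A)) := by gcongr; exact h3
      _ = _ := by
        rw [← mul_assoc, ENNReal.mul_inv_cancel (by simpa using hlo0) ENNReal.ofReal_ne_top,
          one_mul]
  have b3 : ∫⁻ x in A, ‖γ' x‖ₑ ≤ ENNReal.ofReal (m + ε) * volume A := by
    rw [← setLIntegral_const]
    refine setLIntegral_mono measurable_const fun x hx => ?_
    rw [← ofReal_norm]
    exact ENNReal.ofReal_le_ofReal (hsp x hx).2
  have b4 : ENNReal.ofReal (m - ε) * volume A ≤ ∫⁻ x in A, ‖γ' x‖ₑ := by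
    rw [← setLIntegral_const]
    refine setLIntegral_mono' hAm fun x hx => ?_
    rw [← ofReal_norm]
    exact ENNReal.ofReal_le_ofReal (hsp x hx).1
  rw [hhi, ENNReal.ofReal_mul (by linarith), mul_assoc] at b1 b3
  exact ⟨b1.trans (by gcongr), b3.trans (by gcongr)⟩

/-- The length of an injective regular curve is the integral of its speed. -/
theorem hausdorffMeasure_image_eq_lintegral {γ γ' : ℝ → ℂ} {S : Set ℝ} (hS : MeasurableSet S)
    (hd : ∀ x ∈ S, HasStrictDerivAt γ (γ' x) x) (hc : ContinuousOn γ' S)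
    (hne : ∀ x ∈ S, γ' x ≠ 0) (hinj : Set.InjOn γ S) :
    Measure.hausdorffMeasure 1 (γ '' S) = ∫⁻ x in S, ‖γ' x‖ₑ := by
  have key : ∀ c : ℝ, 1 < c →
      Measure.hausdorffMeasure 1 (γ '' S) ≤ ENNReal.ofReal c * ∫⁻ x in S, ‖γ' x‖ₑ ∧
      ∫⁻ x in S, ‖γ' x‖ₑ ≤ ENNReal.ofReal c * Measure.hausdorffMeasure 1 (γ '' S) := by
    intro c hc1
    rcases S.eq_empty_or_nonempty with rfl | hSne
    · simp
    have hex := fun x hx => exists_nhds_hausdorffMeasure_image_comparable (S := S) (hd x hx)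
      (hc x hx) (hne x hx) hc1
    choose! V hV hVA using hex
    have hO : ∀ x ∈ S, ∃ O, IsOpen O ∧ x ∈ O ∧ O ∩ S ⊆ V x := fun x hx =>
      mem_nhdsWithin.mp (hV x hx)
    choose! O hO1 hO2 hO3 using hO
    obtain ⟨t, htS, htc, hcov⟩ := TopologicalSpace.countable_cover_nhdsWithin (s := S) (f := O)
      fun x hx => mem_nhdsWithin_of_mem_nhds ((hO1 x hx).mem_nhds (hO2 x hx))
    have htne : t.Nonempty := by
      obtain ⟨x, hx⟩ := hSne
      obtain ⟨y, hy, -⟩ := Set.mem_iUnion₂.mp (hcov hx)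
      exact ⟨y, hy⟩
    obtain ⟨e, he⟩ := htc.exists_eq_range htne
    have heS : ∀ i, e i ∈ S := fun i => htS (he ▸ Set.mem_range_self i)
    -- A countable measurable partition of `S` into pieces on which the two quantities are
    -- comparable. By injectivity the lengths of the images add up.
    let A : ℕ → Set ℝ := fun i => disjointed (fun j => O (e j)) i ∩ S
    have hAm : ∀ i, MeasurableSet (A i) := fun i =>
      (MeasurableSet.disjointed (fun j => (hO1 _ (heS j)).measurableSet) i).inter hS
    have hAS : ∀ i, A i ⊆ S := fun i => Set.inter_subset_right
    have hAV : ∀ i, A i ⊆ V (e i) := fun i =>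
      (Set.inter_subset_inter_left S (disjointed_subset _ i)).trans (hO3 _ (heS i))
    have hAd : Pairwise (Function.onFun Disjoint A) := fun i j hij =>
      ((disjoint_disjointed _) hij).mono Set.inter_subset_left Set.inter_subset_left
    have hAU : ⋃ i, A i = S := by
      rw [← Set.iUnion_inter, iUnion_disjointed, Set.inter_eq_right]
      rw [he, Set.biUnion_range] at hcov
      exact hcov
    have hcγ : ContinuousOn γ S := fun x hx => (hd x hx).hasDerivAt.continuousAt.continuousWithinAt
    have hH : Measure.hausdorffMeasure 1 (γ '' S) =
        ∑' i, Measure.hausdorffMeasure 1 (γ '' A i) := by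
      rw [← measure_iUnion, ← Set.image_iUnion, hAU]
      · intro i j hij
        exact (hAd hij).image hinj (hAS i) (hAS j)
      · exact fun i => (hAm i).image_of_continuousOn_injOn (hcγ.mono (hAS i)) (hinj.mono (hAS i))
    have hI : ∫⁻ x in S, ‖γ' x‖ₑ = ∑' i, ∫⁻ x in A i, ‖γ' x‖ₑ := by
      rw [← lintegral_iUnion hAm hAd, hAU]
    rw [hH, hI, ← ENNReal.tsum_mul_left, ← ENNReal.tsum_mul_left]
    exact ⟨ENNReal.tsum_le_tsum fun i => (hVA _ (heS i) _ (hAV i) (hAm i)).1,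
      ENNReal.tsum_le_tsum fun i => (hVA _ (heS i) _ (hAV i) (hAm i)).2⟩
  have lim : ∀ {a b : ℝ≥0∞}, (∀ c : ℝ, 1 < c → a ≤ ENNReal.ofReal c * b) → a ≤ b := by
    intro a b h
    have ht : Tendsto (fun c : ℝ => ENNReal.ofReal c * b) (𝓝[>] 1) (𝓝 (ENNReal.ofReal 1 * b)) :=
      ENNReal.Tendsto.mul_const
        ((ENNReal.continuous_ofReal.tendsto 1).mono_left nhdsWithin_le_nhds) (by simp)
    have := ge_of_tendsto ht (by filter_upwards [self_mem_nhdsWithin] with c hc using h c hc)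
    simpa using this
  exact le_antisymm (lim fun c hc => (key c hc).1) (lim fun c hc => (key c hc).2)

/-! ### Second-order jets -/

/-- `f u = a + b u + c u ^ 2 + o(u ^ 2)` at the origin. -/
def HasJet (f : ℂ → ℂ) (a b c : ℂ) : Prop :=
  ∃ h : ℂ → ℂ, ContinuousAt h 0 ∧ h 0 = c ∧ ∀ᶠ u in 𝓝 0, f u = a + b * u + u ^ 2 * h u

theorem HasJet.congr {f g : ℂ → ℂ} {a b c : ℂ} (hf : HasJet f a b c) (h : g =ᶠ[𝓝 0] f) :
    HasJet g a b c := by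
  obtain ⟨k, hk, hk0, hk1⟩ := hf
  exact ⟨k, hk, hk0, by filter_upwards [h, hk1] with u h1 h2 using h1.trans h2⟩

theorem hasJet_const (a : ℂ) : HasJet (fun _ => a) a 0 0 :=
  ⟨fun _ => 0, continuousAt_const, rfl, by simp⟩

theorem hasJet_id : HasJet (fun u => u) 0 1 0 :=
  ⟨fun _ => 0, continuousAt_const, rfl, by simp⟩

theorem hasJet_cube_mul {r : ℂ → ℂ} (hr : ContinuousAt r 0) :
    HasJet (fun u => u ^ 3 * r u) 0 0 0 :=
  ⟨fun u => u * r u, continuousAt_id.mul hr, by simp, .of_forall fun u => by ring⟩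

theorem HasJet.add {f g : ℂ → ℂ} {a b c a' b' c' : ℂ} (hf : HasJet f a b c)
    (hg : HasJet g a' b' c') : HasJet (fun u => f u + g u) (a + a') (b + b') (c + c') := by
  obtain ⟨h, hh, rfl, hf⟩ := hf
  obtain ⟨k, hk, rfl, hg⟩ := hg
  refine ⟨fun u => h u + k u, hh.add hk, rfl, ?_⟩
  filter_upwards [hf, hg] with u h1 h2
  rw [h1, h2]
  ring

theorem HasJet.mul {f g : ℂ → ℂ} {a b c a' b' c' : ℂ} (hf : HasJet f a b c)
    (hg : HasJet g a' b' c') :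
    HasJet (fun u => f u * g u) (a * a') (a * b' + b * a') (a * c' + b * b' + c * a') := by
  obtain ⟨h, hh, rfl, hf⟩ := hf
  obtain ⟨k, hk, rfl, hg⟩ := hg
  refine ⟨fun u => a * k u + b * b' + h u * a' + u * (b * k u + h u * b') + u ^ 2 * (h u * k u),
    by fun_prop, by simp, ?_⟩
  filter_upwards [hf, hg] with u h1 h2
  rw [h1, h2]
  ring

theorem HasJet.pow {f : ℂ → ℂ} {b c : ℂ} (hf : HasJet f 1 b c) (n : ℕ) :
    HasJet (fun u => f u ^ n) 1 (n * b) (n * c + n * (n - 1) / 2 * b ^ 2) := by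
  induction n with
  | zero => simpa using hasJet_const 1
  | succ n ih =>
    convert ih.mul hf using 1
    · ext; ring
    · ring
    · push_cast; ring
    · push_cast; ring

theorem HasJet.unique {f : ℂ → ℂ} {a b c a' b' c' : ℂ} (hf : HasJet f a b c)
    (hf' : HasJet f a' b' c') : a = a' ∧ b = b' ∧ c = c' := by
  obtain ⟨h, hh, rfl, hf⟩ := hf
  obtain ⟨k, hk, rfl, hg⟩ := hf'
  have heq : ∀ {p q : ℂ → ℂ}, ContinuousAt p 0 → ContinuousAt q 0 →
      (∀ᶠ u in 𝓝[≠] 0, p u = q u) → p 0 = q 0 := fun hp hq hpq =>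
    tendsto_nhds_unique ((hp.tendsto.mono_left nhdsWithin_le_nhds).congr' hpq)
      (hq.tendsto.mono_left nhdsWithin_le_nhds)
  have h0 : a = a' := by
    simpa using hf.self_of_nhds.symm.trans hg.self_of_nhds
  subst h0
  have hne : ∀ᶠ u : ℂ in 𝓝[≠] 0, u ≠ 0 := self_mem_nhdsWithin
  have h1 : b = b' := by
    have := heq (p := fun u => b + u * h u) (q := fun u => b' + u * k u) (by fun_prop)
      (by fun_prop) (by
        filter_upwards [hf.filter_mono nhdsWithin_le_nhds, hg.filter_mono nhdsWithin_le_nhds, hne]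
          with u h1 h2 hu
        rw [h1] at h2
        apply mul_left_cancel₀ hu
        linear_combination h2)
    simpa using this
  subst h1
  refine ⟨rfl, rfl, heq hh hk ?_⟩
  filter_upwards [hf.filter_mono nhdsWithin_le_nhds, hg.filter_mono nhdsWithin_le_nhds, hne]
    with u h1 h2 hu
  rw [h1] at h2
  apply mul_left_cancel₀ (pow_ne_zero 2 hu)
  linear_combination h2

theorem exists_taylor_two {f : ℂ → ℂ} {s : Set ℂ} (hs : s ∈ 𝓝 (0 : ℂ))
    (hf : DifferentiableOn ℂ f s) :
    ∃ b : ℂ, ∃ h : ℂ → ℂ, DifferentiableOn ℂ h s ∧ ∀ u, f u = f 0 + b * u + u ^ 2 * h u := by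
  refine ⟨deriv f 0, dslope (dslope f 0) 0, ?_, fun u => ?_⟩
  · rwa [Complex.differentiableOn_dslope hs, Complex.differentiableOn_dslope hs]
  · have h1 := sub_smul_dslope f 0 u
    have h2 := sub_smul_dslope (dslope f 0) 0 u
    rw [dslope_same] at h2
    simp only [sub_zero, smul_eq_mul] at h1 h2
    linear_combination (-1 : ℂ) * h1 - u * h2

/-! ### Square roots and circle means -/

theorem exists_sq_eq_of_ne_zero {F : ℂ → ℂ} {R : ℝ} (hR : 0 < R)
    (hF : DifferentiableOn ℂ F (Metric.ball 0 R)) (hne : ∀ u ∈ Metric.ball (0 : ℂ) R, F u ≠ 0)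
    (h0 : F 0 = 1) :
    ∃ G : ℂ → ℂ, DifferentiableOn ℂ G (Metric.ball 0 R) ∧ G 0 = 1 ∧
      ∀ u ∈ Metric.ball (0 : ℂ) R, F u = G u ^ 2 := by
  have hd : DifferentiableOn ℂ (fun u => deriv F u / F u) (Metric.ball 0 R) :=
    (hF.deriv Metric.isOpen_ball).div hF hne
  obtain ⟨l, hl0, hl⟩ := hd.isExactOn_ball.with_val_at 0 0
  have hmem : (0 : ℂ) ∈ Metric.ball (0 : ℂ) R := Metric.mem_ball_self hR
  refine ⟨fun u => Complex.exp (l u / 2), fun u hu =>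
    ((hl u hu).differentiableAt.div_const 2).cexp.differentiableWithinAt, by simp [hl0],
    fun u hu => ?_⟩
  -- With `l` a primitive of the logarithmic derivative, `F * exp (-l)` is constant, so `exp (l /
  -- 2)` is a square root.
  have hconst : ∀ v ∈ Metric.ball (0 : ℂ) R,
      HasDerivAt (fun v => F v * Complex.exp (-l v)) 0 v := by
    intro v hv
    have h1 := (hF.differentiableAt (Metric.isOpen_ball.mem_nhds hv)).hasDerivAt
    refine (h1.mul (hl v hv).neg.cexp).congr_deriv ?_
    have h2 : F v * (deriv F v / F v) = deriv F v := mul_div_cancel₀ _ (hne v hv)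
    simp only [Pi.neg_apply]
    linear_combination (-Complex.exp (-l v)) * h2
  have h1 := (convex_ball (0 : ℂ) R).is_const_of_fderivWithin_eq_zero (𝕜 := ℂ)
    (f := fun v => F v * Complex.exp (-l v))
    (fun v hv => (hconst v hv).differentiableAt.differentiableWithinAt)
    (fun v hv => by
      rw [fderivWithin_of_isOpen Metric.isOpen_ball hv]
      ext
      simp [(hconst v hv).deriv]) hu hmem
  simp only [h0, hl0, neg_zero, Complex.exp_zero, mul_one] at h1
  rw [Complex.exp_neg] at h1
  rw [← Complex.exp_nat_mul]
  rw [mul_inv_eq_one₀ (Complex.exp_ne_zero _)] at h1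
  rw [h1]
  congr 1
  push_cast
  ring

theorem circleAverage_re {f : ℂ → ℂ} {r : ℝ} (hf : CircleIntegrable f 0 r) :
    Real.circleAverage (fun u => (f u).re) 0 r = (Real.circleAverage f 0 r).re :=
  Complex.reCLM.circleAverage_comp_comm hf

theorem circleAverage_eq_center {f : ℂ → ℂ} {r R : ℝ} (hr : 0 ≤ r) (hrR : r < R)
    (hf : DifferentiableOn ℂ f (Metric.ball 0 R)) : Real.circleAverage f 0 r = f 0 := by
  apply DiffContOnCl.circleAverage
  rw [abs_of_nonneg hr]
  exact hf.diffContOnCl_ball (Metric.closedBall_subset_ball hrR)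

theorem continuousOn_sphere {f : ℂ → ℂ} {r R : ℝ} (hrR : r < R)
    (hf : DifferentiableOn ℂ f (Metric.ball 0 R)) : ContinuousOn f (Metric.sphere 0 r) :=
  hf.continuousOn.mono (Metric.sphere_subset_closedBall.trans (Metric.closedBall_subset_ball hrR))

/-- The mean of `‖F‖` for a nonvanishing `F = 1 + c u ^ 2 + ⋯` through its square root. -/
theorem exists_circleAverage_norm_eq {F : ℂ → ℂ} {R : ℝ} {c : ℂ} (hR : 0 < R)
    (hF : DifferentiableOn ℂ F (Metric.ball 0 R)) (hne : ∀ u ∈ Metric.ball (0 : ℂ) R, F u ≠ 0)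
    (hjet : HasJet F 1 0 c) :
    ∃ K : ℂ → ℂ, DifferentiableOn ℂ K (Metric.ball 0 R) ∧ K 0 = c / 2 ∧
      ∀ r : ℝ, 0 ≤ r → r < R → Real.circleAverage (fun u => ‖F u‖) 0 r =
        1 + r ^ 4 * Real.circleAverage (fun u => ‖K u‖ ^ 2) 0 r := by
  have hball : Metric.ball (0 : ℂ) R ∈ 𝓝 0 := Metric.ball_mem_nhds 0 hR
  have hF0 : F 0 = 1 := by
    obtain ⟨h, -, -, h1⟩ := hjet
    simpa using h1.self_of_nhds
  obtain ⟨G, hG, hG0, hGF⟩ := exists_sq_eq_of_ne_zero hR hF hne hF0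
  obtain ⟨b, K, hK, hGK⟩ := exists_taylor_two hball hG
  have hKc : ContinuousAt K 0 := (hK.differentiableAt hball).continuousAt
  have hGj : HasJet G 1 b (K 0) := ⟨K, hKc, rfl, .of_forall fun u => by rw [hGK u, hG0]⟩
  have hj := (hGj.pow 2).congr (g := F) (by filter_upwards [hball] with u hu using hGF u hu)
  obtain ⟨-, hb, hc⟩ := hj.unique hjet
  have hb0 : b = 0 := by simpa using hb
  subst hb0
  refine ⟨K, hK, by rw [← hc]; push_cast; ring, fun r hr hrR => ?_⟩
  have hKs := continuousOn_sphere hrR hK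
  -- Expand `‖1 + u ^ 2 * K u‖ ^ 2`. The cross term is the real part of a holomorphic function
  -- vanishing at `0`, so it has mean zero.
  have h1 : Set.EqOn (fun u => ‖F u‖)
      (fun u => 1 + ((2 : ℝ) * (u ^ 2 * K u).re + r ^ 4 * ‖K u‖ ^ 2)) (Metric.sphere 0 |r|) := by
    intro u hu
    rw [abs_of_nonneg hr] at hu
    have hu' : ‖u‖ = r := by simpa using hu
    have huB : u ∈ Metric.ball (0 : ℂ) R := by simpa [hu'] using hrR
    have h2 : F u = (1 + u ^ 2 * K u) ^ 2 := by rw [hGF u huB, hGK u, hG0]; ring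
    simp only
    rw [h2, norm_pow, ← Complex.normSq_eq_norm_sq, Complex.normSq_add, Complex.normSq_eq_norm_sq,
      Complex.normSq_eq_norm_sq, norm_mul, norm_pow, hu']
    have h3 : (1 * starRingEnd ℂ (u ^ 2 * K u)).re = (u ^ 2 * K u).re := by
      rw [one_mul, Complex.conj_re]
    rw [h3, norm_one]
    ring
  rw [Real.circleAverage_congr_sphere h1]
  have i1 : CircleIntegrable (fun u => u ^ 2 * K u) 0 r :=
    ContinuousOn.circleIntegrable hr (by fun_prop)
  have i2 : CircleIntegrable (fun u => (2 : ℝ) * (u ^ 2 * K u).re) 0 r :=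
    ContinuousOn.circleIntegrable hr
      (continuousOn_const.mul (Complex.continuous_re.comp_continuousOn (by fun_prop)))
  have i3 : CircleIntegrable (fun u => r ^ 4 * ‖K u‖ ^ 2) 0 r :=
    ContinuousOn.circleIntegrable hr (by fun_prop)
  have i4 : CircleIntegrable (fun u => 2 * (u ^ 2 * K u).re + r ^ 4 * ‖K u‖ ^ 2) 0 r := i2.add i3
  rw [Real.circleAverage_fun_add (f₁ := fun _ => (1 : ℝ)) (circleIntegrable_const 1 0 r)
    i4, Real.circleAverage_const, Real.circleAverage_fun_add i2 i3]
  have e1 := Real.circleAverage_fun_smul (f := fun u => (u ^ 2 * K u).re) (c := 0) (R := r)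
    (a := (2 : ℝ))
  have e2 := Real.circleAverage_fun_smul (f := fun u => ‖K u‖ ^ 2) (c := 0) (R := r)
    (a := r ^ 4)
  simp only [smul_eq_mul] at e1 e2
  rw [e1, e2, circleAverage_re i1, circleAverage_eq_center hr hrR (by fun_prop)]
  simp

/-- Average `0 ≤ ‖K u - K 0‖ ^ 2`; the mean value property evaluates the cross term. -/
theorem sq_norm_center_le_circleAverage {K : ℂ → ℂ} {r R : ℝ} (hr : 0 ≤ r) (hrR : r < R)
    (hK : DifferentiableOn ℂ K (Metric.ball 0 R)) :
    ‖K 0‖ ^ 2 ≤ Real.circleAverage (fun u => ‖K u‖ ^ 2) 0 r := by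
  have hKs := continuousOn_sphere hrR hK
  have i1 : CircleIntegrable (fun u => 2 * starRingEnd ℂ (K 0) * K u) 0 r :=
    ContinuousOn.circleIntegrable hr (by fun_prop)
  have i2 : CircleIntegrable (fun u => (2 * starRingEnd ℂ (K 0) * K u).re) 0 r :=
    ContinuousOn.circleIntegrable hr (Complex.continuous_re.comp_continuousOn (by fun_prop))
  have i3 : CircleIntegrable (fun u => ‖K u‖ ^ 2) 0 r :=
    ContinuousOn.circleIntegrable hr (by fun_prop)
  have h := Real.circleAverage_mono (i2.sub (circleIntegrable_const (‖K 0‖ ^ 2) 0 r)) i3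
    fun u _ => by
      simp only [Pi.sub_apply]
      have h1 := Complex.normSq_sub (K u) (K 0)
      have h2 := Complex.normSq_nonneg (K u - K 0)
      rw [Complex.normSq_eq_norm_sq (K u), Complex.normSq_eq_norm_sq (K 0)] at h1
      have h3 : (2 * starRingEnd ℂ (K 0) * K u).re = 2 * (K u * starRingEnd ℂ (K 0)).re := by
        simp; ring
      linarith
  rw [Real.circleAverage_sub i2 (circleIntegrable_const _ 0 r), Real.circleAverage_const,
    circleAverage_re i1, circleAverage_eq_center hr hrR (by fun_prop)] at h
  have h4 : (2 * starRingEnd ℂ (K 0) * K 0).re = 2 * ‖K 0‖ ^ 2 := by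
    rw [mul_assoc, mul_comm (starRingEnd ℂ (K 0)), Complex.mul_conj, Complex.normSq_eq_norm_sq]
    norm_cast
  linarith

theorem tendsto_circleAverage_sq_norm {K : ℂ → ℂ} {R : ℝ} (hR : 0 < R)
    (hK : DifferentiableOn ℂ K (Metric.ball 0 R)) :
    Tendsto (fun r => Real.circleAverage (fun u => ‖K u‖ ^ 2) 0 r) (𝓝[>] 0)
      (𝓝 (‖K 0‖ ^ 2)) := by
  have h : ContinuousOn (Real.circleAverage (fun u => ‖K u‖ ^ 2) 0) (Set.Ico 0 R) := by
    refine Real.ContinuousOn.circleAverage ?_ fun r hr => hr.1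
    have := hK.continuousOn
    refine ContinuousOn.mono (s := Metric.ball 0 R) (by fun_prop) fun u hu => ?_
    simpa using hu.2
  have h1 := h 0 ⟨le_rfl, hR⟩
  rw [ContinuousWithinAt, Real.circleAverage_zero] at h1
  exact h1.mono_left (nhdsWithin_le_iff.mpr (mem_of_superset (Ioo_mem_nhdsGT hR)
    Set.Ioo_subset_Ico_self))

/-! ### Łojasiewicz inequality and an integrable weight -/

/-- A Łojasiewicz inequality: `‖P z - P ζ‖` is controlled by `‖P' z‖` for the critical point `ζ`
nearest to `z`. -/
theorem exists_criticalPoint_norm_sub_pow_le {P : ℂ[X]} (hP : P.Monic) (hn : 2 ≤ P.natDegree)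
    (z : ℂ) :
    ∃ ζ : ℂ, (derivative P).eval ζ = 0 ∧
      ‖P.eval z - P.eval ζ‖ ^ (P.natDegree - 1) ≤
        2 ^ (P.natDegree - 1) ^ 2 * ‖(derivative P).eval z‖ ^ P.natDegree := by
  set n := P.natDegree with hnn
  set Q := derivative P with hQ
  have hdeg : Q.natDegree = n - 1 := natDegree_derivative P
  have hQ0 : Q ≠ 0 := by
    rintro h
    rw [h, natDegree_zero] at hdeg
    omega
  have hsp : Q.Splits := IsAlgClosed.splits Q
  have hcard : Q.roots.card = n - 1 := by rw [← hdeg, hsp.natDegree_eq_card_roots]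
  have hlead : ‖Q.leadingCoeff‖ = n := by
    rw [leadingCoeff, hdeg, hQ, coeff_derivative, Nat.sub_add_cancel (by omega), hnn,
      hP.coeff_natDegree, ← hnn]
    have : ((n - 1 : ℕ) : ℂ) + 1 = (n : ℂ) := by
      rw [← Nat.cast_add_one, Nat.sub_add_cancel (by omega)]
    rw [this]
    simp
  have heval : ∀ y, ‖Q.eval y‖ = n * (Q.roots.map fun a => ‖y - a‖).prod := by
    intro y
    conv_lhs => rw [hsp.eq_prod_roots]
    rw [eval_mul, eval_C, norm_mul, hlead, eval_multiset_prod, Multiset.map_map]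
    congr 1
    rw [show ‖(Q.roots.map (eval y ∘ fun a => X - C a)).prod‖ =
      normHom ((Q.roots.map (eval y ∘ fun a => X - C a)).prod) from rfl, map_multiset_prod,
      Multiset.map_map]
    simp
  have hne : Q.roots.toFinset.Nonempty := by
    obtain ⟨a, ha⟩ := Multiset.card_pos_iff_exists_mem.mp (by rw [hcard]; omega : 0 < Q.roots.card)
    exact ⟨a, Multiset.mem_toFinset.mpr ha⟩
  obtain ⟨ζ, hζ, hmin⟩ := Q.roots.toFinset.exists_min_image (fun a => ‖z - a‖) hne
  have hmin' : ∀ a ∈ Q.roots, ‖z - ζ‖ ≤ ‖z - a‖ := fun a ha =>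
    hmin a (Multiset.mem_toFinset.mpr ha)
  have hζ0 : Q.eval ζ = 0 := (mem_roots hQ0).mp (Multiset.mem_toFinset.mp hζ)
  refine ⟨ζ, hζ0, ?_⟩
  -- Since `‖y - z‖ ≤ ‖z - ζ‖ ≤ ‖z - a‖` for every root `a` of `Q`, each of the `n - 1` factors of
  -- `Q` at most doubles.
  have hseg : ∀ y ∈ segment ℝ ζ z, ‖Q.eval y‖ ≤ 2 ^ (n - 1) * ‖Q.eval z‖ := by
    intro y hy
    rw [heval, heval, mul_left_comm, ← hcard, ← Multiset.prod_replicate,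
      ← Multiset.map_const', ← Multiset.prod_map_mul]
    gcongr
    refine Multiset.prod_map_le_prod_map₀ _ _ (fun _ _ => norm_nonneg _) fun a ha => ?_
    have h1 : ‖y - z‖ ≤ ‖z - ζ‖ := by
      have := segment_subset_closedBall_right ζ z hy
      rwa [Metric.mem_closedBall, dist_comm ζ z, dist_eq_norm, dist_eq_norm] at this
    have h2 : ‖y - a‖ ≤ ‖y - z‖ + ‖z - a‖ := norm_sub_le_norm_sub_add_norm_sub _ _ _
    linarith [hmin' a ha]
  have hmvt : ‖P.eval z - P.eval ζ‖ ≤ 2 ^ (n - 1) * ‖Q.eval z‖ * ‖z - ζ‖ :=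
    (convex_segment (𝕜 := ℝ) ζ z).norm_image_sub_le_of_norm_hasDerivWithin_le
      (fun y _ => (P.hasDerivAt y).hasDerivWithinAt) hseg (left_mem_segment ℝ ζ z)
      (right_mem_segment ℝ ζ z)
  have hd : ‖z - ζ‖ ^ (n - 1) ≤ ‖Q.eval z‖ := by
    rw [heval, ← hcard, ← Multiset.prod_replicate, ← Multiset.map_const']
    have h1 : (Q.roots.map fun _ => ‖z - ζ‖).prod ≤ (Q.roots.map fun a => ‖z - a‖).prod :=
      Multiset.prod_map_le_prod_map₀ _ _ (fun _ _ => norm_nonneg _) hmin'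
    have h2 : 0 ≤ (Q.roots.map fun a => ‖z - a‖).prod :=
      Multiset.prod_map_nonneg fun _ _ => norm_nonneg _
    refine h1.trans (le_mul_of_one_le_left h2 ?_)
    exact_mod_cast (by omega : 1 ≤ n)
  calc ‖P.eval z - P.eval ζ‖ ^ (n - 1)
      ≤ (2 ^ (n - 1) * ‖Q.eval z‖ * ‖z - ζ‖) ^ (n - 1) := by gcongr
    _ = 2 ^ (n - 1) ^ 2 * (‖Q.eval z‖ ^ (n - 1) * ‖z - ζ‖ ^ (n - 1)) := by
      rw [mul_pow, mul_pow, ← pow_mul, sq]; ring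
    _ ≤ 2 ^ (n - 1) ^ 2 * (‖Q.eval z‖ ^ (n - 1) * ‖Q.eval z‖) := by gcongr
    _ = 2 ^ (n - 1) ^ 2 * ‖Q.eval z‖ ^ n := by
      rw [← pow_succ, Nat.sub_add_cancel (by omega)]

/-- The previous inequality with `y = u * z`: both sides scale by `‖u‖ ^ (n * (n - 1))`. -/
theorem exists_criticalPoint_norm_one_sub_pow_le {P : ℂ[X]} (hP : P.Monic)
    (hn : 2 ≤ P.natDegree) {u y : ℂ} (hu : u ≠ 0) (h : homog P u y = 1) :
    ∃ ζ : ℂ, (derivative P).eval ζ = 0 ∧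
      ‖1 - u ^ P.natDegree * P.eval ζ‖ ^ (P.natDegree - 1) ≤
        2 ^ (P.natDegree - 1) ^ 2 * ‖homogDeriv P u y‖ ^ P.natDegree := by
  obtain ⟨z, rfl⟩ : ∃ z, y = u * z := ⟨y / u, by field_simp⟩
  obtain ⟨ζ, hζ, hle⟩ := exists_criticalPoint_norm_sub_pow_le hP hn z
  refine ⟨ζ, hζ, ?_⟩
  rw [homog_mul_right] at h
  rw [homogDeriv_mul_right (by omega) hu]
  have h1 : 1 - u ^ P.natDegree * P.eval ζ = u ^ P.natDegree * (P.eval z - P.eval ζ) := by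
    rw [mul_sub, h]
  rw [h1, norm_mul, norm_mul, norm_pow, norm_pow, mul_pow, mul_pow, ← pow_mul, ← pow_mul,
    mul_comm (P.natDegree - 1)]
  calc ‖u‖ ^ (P.natDegree * (P.natDegree - 1)) * ‖P.eval z - P.eval ζ‖ ^ (P.natDegree - 1)
      ≤ ‖u‖ ^ (P.natDegree * (P.natDegree - 1)) *
        (2 ^ (P.natDegree - 1) ^ 2 * ‖(derivative P).eval z‖ ^ P.natDegree) := by gcongr
    _ = _ := by ring

/-- The weight `‖exp (i x) - 1‖ ^ (-a)`, with an integrable singularity at `0` when `a < 1`. -/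
noncomputable def circleWeight (a x : ℝ) : ℝ := ‖Complex.exp (Complex.I * x) - 1‖ ^ (-a)

theorem circleWeight_nonneg (a x : ℝ) : 0 ≤ circleWeight a x := by
  unfold circleWeight; positivity

theorem intervalIntegrable_circleWeight {a : ℝ} (ha0 : 0 ≤ a) (ha : a < 1) (x y : ℝ) :
    IntervalIntegrable (circleWeight a) volume x y := by
  have hmeas : Measurable (circleWeight a) := by unfold circleWeight; fun_prop
  have h1 : IntervalIntegrable (circleWeight a) volume 0 Real.pi := by
    have h2 : IntervalIntegrable (fun x : ℝ => (2 / Real.pi) ^ (-a) * x ^ (-a)) volume 0 Real.pi :=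
      (intervalIntegral.intervalIntegrable_rpow' (by linarith)).const_mul _
    refine h2.mono_fun' hmeas.aestronglyMeasurable ?_
    rw [Set.uIoc_of_le Real.pi_pos.le]
    refine (ae_restrict_mem measurableSet_Ioc).mono fun x hx => ?_
    beta_reduce
    rw [Real.norm_of_nonneg (circleWeight_nonneg a x),
      ← Real.mul_rpow (by positivity) hx.1.le, circleWeight]
    refine Real.rpow_le_rpow_of_nonpos (by have := hx.1; positivity) ?_ (by linarith)
    -- Jordan's inequality reduces the weight to a power of `x` with exponent above `-1`.
    have h3 := Real.mul_abs_le_abs_sin (x := x / 2) (by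
      rw [abs_of_pos (by linarith [hx.1])]; linarith [hx.2])
    rw [Complex.norm_exp_I_mul_ofReal_sub_one, norm_mul, Real.norm_eq_abs, Real.norm_eq_abs,
      abs_two]
    rw [abs_of_pos (by linarith [hx.1] : 0 < x / 2)] at h3
    calc 2 / Real.pi * x = 2 * (2 / Real.pi * (x / 2)) := by ring
      _ ≤ _ := by gcongr
  have heven : ∀ x, circleWeight a (-x) = circleWeight a x := fun x => by
    rw [circleWeight, circleWeight, Complex.norm_exp_I_mul_ofReal_sub_one,
      Complex.norm_exp_I_mul_ofReal_sub_one, neg_div, Real.sin_neg, mul_neg, norm_neg]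
  have h2 : IntervalIntegrable (circleWeight a) volume (-Real.pi) 0 := by
    have := (IntervalIntegrable.iff_comp_neg (f := circleWeight a)).mp h1
    simp only [heven, neg_zero] at this
    exact this.symm
  have hper : Function.Periodic (circleWeight a) (2 * Real.pi) := fun x => by
    rw [circleWeight, circleWeight]
    congr 3
    push_cast
    rw [mul_add, mul_comm Complex.I (2 * Real.pi), Complex.exp_add, Complex.exp_two_pi_mul_I,
      mul_one]
  refine hper.intervalIntegrable (t := -Real.pi) (by positivity) ?_ x y
  convert h2.trans h1 using 1
  ring

/-- Replaces the radius-dependent `‖1 - s * e‖` by a quantity depending on the angle alone, so that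
one majorant serves all radii. -/
theorem norm_sub_one_le_two_mul {e : ℂ} (he : ‖e‖ = 1) {s : ℝ} (hs0 : 0 ≤ s) (hs1 : s ≤ 1) :
    ‖e - 1‖ ≤ 2 * ‖1 - s * e‖ := by
  have h1 : ‖(1 - s) * e‖ = 1 - s := by
    rw [norm_mul, he, mul_one, ← Complex.ofReal_one, ← Complex.ofReal_sub, Complex.norm_real,
      Real.norm_of_nonneg (by linarith)]
  have h2 : 1 - s ≤ ‖1 - s * e‖ := by
    have := norm_sub_norm_le (1 : ℂ) (s * e)
    rwa [norm_one, norm_mul, he, mul_one, Complex.norm_real, Real.norm_of_nonneg hs0] at this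
  have h3 : e - 1 = (1 - s) * e - (1 - s * e) := by ring
  rw [h3]
  refine (norm_sub_le _ _).trans ?_
  rw [h1]
  linarith

/-! ### Circles up to the critical one and the majorant of the speed -/

/-- The angles excluded on a circle: those at which a critical value may be met. -/
def badAngles (P : ℂ[X]) : Set ℝ :=
  {θ | ∃ ζ, (derivative P).eval ζ = 0 ∧
    Complex.exp (Complex.I * (P.natDegree * θ + (P.eval ζ).arg : ℝ)) = 1}

theorem countable_badAngles {P : ℂ[X]} (hn : P.natDegree ≠ 0) : (badAngles P).Countable := by
  have : badAngles P ⊆ ⋃ ζ ∈ {ζ : ℂ | (derivative P).eval ζ = 0},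
      Set.range fun k : ℤ => (k * (2 * Real.pi) - (P.eval ζ).arg) / P.natDegree := by
    rintro θ ⟨ζ, hζ, h⟩
    simp only [Set.mem_iUnion]
    refine ⟨ζ, hζ, ?_⟩
    obtain ⟨k, hk⟩ := Complex.exp_eq_one_iff.mp h
    have h1 : Complex.I * ((P.natDegree * θ + (P.eval ζ).arg : ℝ) : ℂ) =
        Complex.I * ((k * (2 * Real.pi) : ℝ) : ℂ) := by rw [hk]; push_cast; ring
    have h2 := Complex.ofReal_injective (mul_left_cancel₀ Complex.I_ne_zero h1)
    refine ⟨k, ?_⟩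
    have : (P.natDegree : ℝ) ≠ 0 := by exact_mod_cast hn
    simp only
    rw [div_eq_iff this, ← h2]
    ring
  exact ((finite_criticalPoints hn).countable.biUnion fun ζ _ => Set.countable_range _).mono this

theorem circleMap_pow_mul_eval (P : ℂ[X]) (r θ : ℝ) (ζ : ℂ) :
    circleMap 0 r θ ^ P.natDegree * P.eval ζ =
      ((r ^ P.natDegree * ‖P.eval ζ‖ : ℝ) : ℂ) *
        Complex.exp (Complex.I * (P.natDegree * θ + (P.eval ζ).arg : ℝ)) := by
  conv_lhs => rw [← Complex.norm_mul_exp_arg_mul_I (P.eval ζ)]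
  rw [circleMap_zero, mul_pow, ← Complex.exp_nat_mul]
  push_cast
  rw [mul_add Complex.I, Complex.exp_add]
  ring_nf

theorem norm_exp_I_mul (x : ℝ) : ‖Complex.exp (Complex.I * x)‖ = 1 := by
  rw [mul_comm, Complex.norm_exp_ofReal_mul_I]

/-- With `s ≤ 1` and `‖e‖ = 1`, the number `1 - s * e` leaves the slit plane only when `s = 1` and
`e = 1`, and a good angle rules out the latter. -/
theorem circleMap_mem_starDomain {P : ℂ[X]} {r θ : ℝ} (hr : 0 ≤ r)
    (hcrit : ∀ ζ, (derivative P).eval ζ = 0 → r ^ P.natDegree * ‖P.eval ζ‖ ≤ 1)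
    (hθ : θ ∉ badAngles P) : circleMap 0 r θ ∈ starDomain P := by
  intro ζ hζ
  rw [circleMap_pow_mul_eval]
  set s := r ^ P.natDegree * ‖P.eval ζ‖ with hs
  have hs0 : 0 ≤ s := by positivity
  have hs1 : s ≤ 1 := hcrit ζ hζ
  have hne : Complex.exp (Complex.I * (P.natDegree * θ + (P.eval ζ).arg : ℝ)) ≠ 1 :=
    fun h => hθ ⟨ζ, hζ, h⟩
  have hnorm := norm_exp_I_mul (P.natDegree * θ + (P.eval ζ).arg)
  set e := Complex.exp (Complex.I * (P.natDegree * θ + (P.eval ζ).arg : ℝ))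
  rw [Complex.mem_slitPlane_iff]
  by_contra! hcon
  obtain ⟨h1, h2⟩ := hcon
  simp only [Complex.sub_re, Complex.one_re, Complex.re_ofReal_mul] at h1
  have h3 : e.re ≤ 1 := hnorm ▸ Complex.re_le_norm e
  have h4 : e.re = 1 := by
    have hs' : s = 1 := by nlinarith
    rw [hs'] at h1
    linarith
  apply hne
  have h5 : e.im = 0 := by
    have h6 := Complex.sq_norm e
    rw [hnorm, Complex.normSq_apply, h4] at h6
    nlinarith
  exact Complex.ext h4 h5

theorem mem_starDomain_of_norm_lt {P : ℂ[X]} (hn : P.natDegree ≠ 0) {R : ℝ}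
    (hcrit : ∀ ζ, (derivative P).eval ζ = 0 → R ^ P.natDegree * ‖P.eval ζ‖ ≤ 1) {u : ℂ}
    (hu : ‖u‖ < R) : u ∈ starDomain P := by
  intro ζ hζ
  rw [sub_eq_add_neg]
  apply Complex.mem_slitPlane_of_norm_lt_one
  rw [norm_neg, norm_mul, norm_pow]
  by_cases h0 : ‖P.eval ζ‖ = 0
  · simp [h0]
  · refine lt_of_lt_of_le ?_ (hcrit ζ hζ)
    gcongr

/-- The integrable majorant of the speed on the circles inside the star domain. -/
noncomputable def majorant (P : ℂ[X]) (θ : ℝ) : ℝ :=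
  ∑ᶠ ζ ∈ {ζ : ℂ | (derivative P).eval ζ = 0},
    circleWeight ((P.natDegree - 1) / P.natDegree) (P.natDegree * θ + (P.eval ζ).arg)

theorem intervalIntegrable_majorant {P : ℂ[X]} (hn : P.natDegree ≠ 0) (x y : ℝ) :
    IntervalIntegrable (majorant P) volume x y := by
  have hn0 : (0 : ℝ) < P.natDegree := by exact_mod_cast Nat.pos_of_ne_zero hn
  have hn1 : (1 : ℝ) ≤ P.natDegree := by exact_mod_cast Nat.pos_of_ne_zero hn
  have h1 : majorant P = ∑ ζ ∈ (finite_criticalPoints hn).toFinset, fun θ =>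
      circleWeight ((P.natDegree - 1) / P.natDegree) (P.natDegree * θ + (P.eval ζ).arg) := by
    ext θ
    rw [majorant, finsum_mem_eq_finite_toFinset_sum _ (finite_criticalPoints hn),
      Finset.sum_apply]
  rw [h1]
  refine IntervalIntegrable.sum _ fun ζ _ => ?_
  have h2 := intervalIntegrable_circleWeight (a := (P.natDegree - 1) / P.natDegree)
    (div_nonneg (by linarith) hn0.le) (by rw [div_lt_one hn0]; linarith)
    (P.natDegree * x + (P.eval ζ).arg) (P.natDegree * y + (P.eval ζ).arg)
  have h3 := (h2.comp_add_right (P.eval ζ).arg).comp_mul_left (c := (P.natDegree : ℝ))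
  simpa [hn0.ne'] using h3

/-- The `n`-th root of the Łojasiewicz inequality yields the exponent `(n - 1) / n < 1`. The
relevant `ζ` varies with the point, so the majorant sums over all critical points. -/
theorem exists_norm_inv_homogDeriv_le_majorant {P : ℂ[X]} (hP : P.Monic) (hn : 2 ≤ P.natDegree) :
    ∃ C : ℝ, ∀ (r θ : ℝ) (y : ℂ), 0 < r →
      (∀ ζ, (derivative P).eval ζ = 0 → r ^ P.natDegree * ‖P.eval ζ‖ ≤ 1) →
      θ ∉ badAngles P → homog P (circleMap 0 r θ) y = 1 →
      ‖homogDeriv P (circleMap 0 r θ) y‖⁻¹ ≤ C * majorant P θ := by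
  set n := P.natDegree with hnn
  have hn0 : (0 : ℝ) < n := by exact_mod_cast (by omega : 0 < n)
  have hne : P.natDegree ≠ 0 := by omega
  set a : ℝ := (n - 1) / n with ha
  have ha0 : 0 ≤ a := by
    have : (1 : ℝ) ≤ n := by exact_mod_cast (by omega : 1 ≤ n)
    exact div_nonneg (by linarith) hn0.le
  refine ⟨((2 : ℝ) ^ (n - 1) ^ 2) ^ (1 / (n : ℝ)) * 2 ^ a, fun r θ y hr hcrit hθ hy => ?_⟩
  have hu : circleMap 0 r θ ≠ 0 := circleMap_ne_center hr.ne'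
  obtain ⟨ζ, hζ, hle⟩ := exists_criticalPoint_norm_one_sub_pow_le hP hn hu hy
  have hD0 : 0 < ‖homogDeriv P (circleMap 0 r θ) y‖ := norm_pos_iff.mpr
    (homogDeriv_ne_zero hP hne (circleMap_mem_starDomain hr.le hcrit hθ) hy)
  set D := ‖homogDeriv P (circleMap 0 r θ) y‖
  rw [circleMap_pow_mul_eval, ← hnn] at hle
  have hexp : Complex.exp (Complex.I * (n * θ + (P.eval ζ).arg : ℝ)) ≠ 1 :=
    fun h => hθ ⟨ζ, hζ, h⟩
  have h1 := norm_sub_one_le_two_mul (norm_exp_I_mul (n * θ + (P.eval ζ).arg))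
    (s := r ^ n * ‖P.eval ζ‖) (by positivity) (hcrit ζ hζ)
  set x := ‖1 - ((r ^ n * ‖P.eval ζ‖ : ℝ) : ℂ) *
    Complex.exp (Complex.I * (n * θ + (P.eval ζ).arg : ℝ))‖
  set w := ‖Complex.exp (Complex.I * (n * θ + (P.eval ζ).arg : ℝ)) - 1‖ with hw
  have hw0 : 0 < w := norm_pos_iff.mpr (sub_ne_zero.mpr hexp)
  have hx0 : 0 < x := by linarith
  have h2 : x ^ a ≤ ((2 : ℝ) ^ (n - 1) ^ 2) ^ (1 / (n : ℝ)) * D := by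
    have h3 := Real.rpow_le_rpow (by positivity) hle (by positivity : 0 ≤ 1 / (n : ℝ))
    rw [Real.mul_rpow (by positivity) (by positivity), ← Real.rpow_natCast D,
      ← Real.rpow_mul hD0.le, ← Real.rpow_natCast x, ← Real.rpow_mul hx0.le,
      mul_one_div_cancel hn0.ne', Real.rpow_one, mul_one_div, Nat.cast_sub (by omega),
      Nat.cast_one] at h3
    exact h3
  have h4 : D⁻¹ ≤ ((2 : ℝ) ^ (n - 1) ^ 2) ^ (1 / (n : ℝ)) * x ^ (-a) := by
    rw [Real.rpow_neg hx0.le, ← div_eq_mul_inv, le_div_iff₀ (by positivity),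
      inv_mul_le_iff₀ hD0, mul_comm D]
    exact h2
  have h5 : x ^ (-a) ≤ 2 ^ a * circleWeight a (n * θ + (P.eval ζ).arg) := by
    rw [circleWeight, ← hw]
    calc x ^ (-a) ≤ (w / 2) ^ (-a) :=
          Real.rpow_le_rpow_of_nonpos (by positivity) (by linarith) (by linarith)
      _ = 2 ^ a * w ^ (-a) := by
        rw [Real.div_rpow hw0.le zero_le_two, Real.rpow_neg zero_le_two, div_inv_eq_mul, mul_comm]
  have h6 : circleWeight a (n * θ + (P.eval ζ).arg) ≤ majorant P θ := by
    rw [majorant, finsum_mem_eq_finite_toFinset_sum _ (finite_criticalPoints hne), ← hnn]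
    exact Finset.single_le_sum (f := fun ζ => circleWeight a (n * θ + (P.eval ζ).arg))
      (fun _ _ => circleWeight_nonneg _ _)
      ((finite_criticalPoints hne).mem_toFinset.mpr hζ)
  rw [mul_assoc]
  refine h4.trans ?_
  gcongr
  refine h5.trans ?_
  gcongr

/-! ### The normalized branch and its speed -/

/-- `k` is the branch over the star domain of the root of `homog P u y = 1` with `k 0 = 1`, so that
`w ↦ w * k (1 / w)` inverts the `n`-th root of `P` near infinity. -/
structure IsBranch (P : ℂ[X]) (k : ℂ → ℂ) : Prop where
  continuousOn : ContinuousOn k (starDomain P)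
  homog_eq : ∀ u ∈ starDomain P, homog P u (k u) = 1
  map_zero : k 0 = 1

/-- In terms of the inverse `ψ` of the `n`-th root of `P`, this is `ψ' (1 / u)`. -/
noncomputable def speed (P : ℂ[X]) (k : ℂ → ℂ) (u : ℂ) : ℂ := P.natDegree / homogDeriv P u (k u)

theorem exists_isBranch {P : ℂ[X]} (hP : P.Monic) (hn : P.natDegree ≠ 0) :
    ∃ k, IsBranch P k := by
  obtain ⟨k, h1, h2, h3⟩ := exists_branch hP hn (u₀ := 0) (y₀ := 1) (zero_mem_starDomain hn)
    (by rw [homog_zero_left hP, one_pow])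
  exact ⟨k, h1, h3, h2⟩

theorem continuousOn_rotate {P : ℂ[X]} {k : ℂ → ℂ} (hk : ContinuousOn k (starDomain P)) {c : ℂ}
    (hc : c ^ P.natDegree = 1) : ContinuousOn (fun u => c⁻¹ * k (c * u)) (starDomain P) :=
  continuousOn_const.mul (hk.comp (by fun_prop) fun _ hu => mul_mem_starDomain hc hu)

/-- By homogeneity, rotation by an `n`-th root of unity carries branches to branches; this symmetry
drives both injectivity and surjectivity of the parametrization. -/
theorem homog_rotate {P : ℂ[X]} {k : ℂ → ℂ} (hk : ∀ u ∈ starDomain P, homog P u (k u) = 1) {c : ℂ}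
    (hc0 : c ≠ 0) (hc : c ^ P.natDegree = 1) : ∀ u ∈ starDomain P,
      homog P u (c⁻¹ * k (c * u)) = 1 := by
  intro u hu
  have h := homog_mul_mul P c u (c⁻¹ * k (c * u))
  rw [mul_inv_cancel_left₀ hc0, hc, one_mul] at h
  rw [← h, hk _ (mul_mem_starDomain hc hu)]

namespace IsBranch

variable {P : ℂ[X]} {k : ℂ → ℂ}

theorem differentiableOn (hk : IsBranch P k) (hP : P.Monic) (hn : P.natDegree ≠ 0) :
    DifferentiableOn ℂ k (starDomain P) :=
  differentiableOn_branch hP hn hk.continuousOn hk.homog_eq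

theorem speed_ne_zero (hk : IsBranch P k) (hP : P.Monic) (hn : P.natDegree ≠ 0) {u : ℂ}
    (hu : u ∈ starDomain P) : speed P k u ≠ 0 :=
  div_ne_zero (Nat.cast_ne_zero.mpr hn) (homogDeriv_ne_zero hP hn hu (hk.homog_eq u hu))

theorem continuousOn_speed (hk : IsBranch P k) (hP : P.Monic) (hn : P.natDegree ≠ 0) :
    ContinuousOn (speed P k) (starDomain P) :=
  continuousOn_const.div
    ((continuous_homogDeriv P).comp_continuousOn (continuousOn_id.prodMk hk.continuousOn))
    fun u hu => homogDeriv_ne_zero hP hn hu (hk.homog_eq u hu)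

/-- Euler's identity: the differential of `homog` at `(u, k u)` sends `(u, k u)` to `n`, kills the
tangent `(1, k')` of the level curve, and sends `(0, 1)` to `homogDeriv`. Decompose `(u, k u)` along
the last two vectors. -/
theorem speed_eq (hk : IsBranch P k) (hP : P.Monic) (hn : P.natDegree ≠ 0) {u : ℂ}
    (hu : u ∈ starDomain P) : speed P k u = k u - u * deriv k u := by
  have hnhds := (isOpen_starDomain hn).mem_nhds hu
  have hD0 := homogDeriv_ne_zero hP hn hu (hk.homog_eq u hu)
  have hk' : HasDerivAt k (deriv k u) u :=
    ((hk.differentiableOn hP hn).differentiableAt hnhds).hasDerivAt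
  have hD : HasFDerivAt (fun p : ℂ × ℂ => homog P p.1 p.2)
      (fderiv ℂ (fun p : ℂ × ℂ => homog P p.1 p.2) (u, k u)) (u, k u) :=
    ((contDiff_homog P).differentiable one_ne_zero _).hasFDerivAt
  set D := fderiv ℂ (fun p : ℂ × ℂ => homog P p.1 p.2) (u, k u)
  have e1 : D (1, deriv k u) = 0 := by
    have h1 := hD.comp_hasDerivAt u ((hasDerivAt_id u).prodMk hk')
    have h2 : HasDerivAt (fun _ : ℂ => (1 : ℂ)) 0 u := hasDerivAt_const _ _
    refine h1.unique (h2.congr_of_eventuallyEq ?_)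
    filter_upwards [hnhds] with v hv using hk.homog_eq v hv
  have e2 : D (0, 1) = homogDeriv P u (k u) := by
    have h1 := hD.comp_hasDerivAt (k u) ((hasDerivAt_const (k u) u).prodMk (hasDerivAt_id (k u)))
    exact h1.unique (hasDerivAt_homog P u (k u))
  have e3 : D (u, k u) = P.natDegree := by
    have hc : HasDerivAt (fun c : ℂ => (c * u, c * k u)) (u, k u) 1 := by
      simpa using ((hasDerivAt_id (1 : ℂ)).mul_const u).prodMk
        ((hasDerivAt_id (1 : ℂ)).mul_const (k u))
    have hD' : HasFDerivAt (fun p : ℂ × ℂ => homog P p.1 p.2) D ((1 : ℂ) * u, (1 : ℂ) * k u) := by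
      simpa using hD
    have h1 := HasFDerivAt.comp_hasDerivAt (x := (1 : ℂ)) (hl := hD') (hf := hc)
    have h2 : HasDerivAt (fun c : ℂ => c ^ P.natDegree) (P.natDegree : ℂ) 1 := by
      simpa using hasDerivAt_pow P.natDegree (1 : ℂ)
    refine h1.unique (h2.congr_of_eventuallyEq (.of_forall fun c => ?_))
    simp [homog_mul_mul, hk.homog_eq u hu]
  have e4 : ((u, k u) : ℂ × ℂ) =
      u • ((1 : ℂ), deriv k u) + (k u - u * deriv k u) • ((0 : ℂ), (1 : ℂ)) := by
    ext <;> simp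
  rw [e4, map_add, map_smul, map_smul, e1, e2, smul_zero, zero_add, smul_eq_mul] at e3
  rw [speed, div_eq_iff hD0, e3]

/-- If `k = 1 + b u + M u ^ 2`, then `k - u k'` has no linear term and quadratic coefficient `-M 0`.
The values of `b` and `M 0` come from the first two coefficients of `homog P u (k u) = 1`. -/
theorem hasJet_speed (hk : IsBranch P k) (hP : P.Monic) (hn : 2 ≤ P.natDegree) :
    HasJet (speed P k) 1 0
      (-((((P.natDegree : ℂ) - 1) * P.coeff (P.natDegree - 1) ^ 2 -
        2 * P.natDegree * P.coeff (P.natDegree - 2)) / (2 * (P.natDegree : ℂ) ^ 2))) := by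
  have hn0 : P.natDegree ≠ 0 := by omega
  have hmem : starDomain P ∈ 𝓝 (0 : ℂ) :=
    (isOpen_starDomain hn0).mem_nhds (zero_mem_starDomain hn0)
  obtain ⟨b, M, hM, hkM⟩ := exists_taylor_two hmem (hk.differentiableOn hP hn0)
  simp only [hk.map_zero] at hkM
  have hMc : ContinuousAt M 0 := (hM.differentiableAt hmem).continuousAt
  have hkj : HasJet k 1 b (M 0) := ⟨M, hMc, rfl, .of_forall hkM⟩
  have hkc : ContinuousAt k 0 := hk.continuousOn.continuousAt hmem
  have hcoef : -M 0 = -((((P.natDegree : ℂ) - 1) * P.coeff (P.natDegree - 1) ^ 2 -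
        2 * P.natDegree * P.coeff (P.natDegree - 2)) / (2 * (P.natDegree : ℂ) ^ 2)) := by
    obtain ⟨m, hm⟩ := Nat.exists_eq_add_of_le' hn
    have hsplit : ∀ u y, homog P u y =
        (y ^ (m + 2) + P.coeff (m + 1) * (u * y ^ (m + 1))) + (P.coeff m * ((u * u) * y ^ m) +
        u ^ 3 * ∑ i ∈ Finset.range m, P.coeff i * u ^ (m - 1 - i) * y ^ i) := by
      intro u y
      have hlc := hP.coeff_natDegree
      rw [hm] at hlc
      rw [homog_eq_sum, hm, Finset.sum_range_succ, Finset.sum_range_succ, Finset.sum_range_succ,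
        hlc, Finset.mul_sum]
      have h1 : ∑ i ∈ Finset.range m, P.coeff i * u ^ (m + 2 - i) * y ^ i =
          ∑ i ∈ Finset.range m, u ^ 3 * (P.coeff i * u ^ (m - 1 - i) * y ^ i) := by
        refine Finset.sum_congr rfl fun i hi => ?_
        have : m + 2 - i = 3 + (m - 1 - i) := by
          have := Finset.mem_range.mp hi
          omega
        rw [this, pow_add]
        ring
      rw [h1, show m + 2 - m = 2 by omega, show m + 2 - (m + 1) = 1 by omega, Nat.sub_self]
      ring
    have hj := ((hkj.pow (m + 2)).add
      ((hasJet_const (P.coeff (m + 1))).mul (hasJet_id.mul (hkj.pow (m + 1))))).add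
      (((hasJet_const (P.coeff m)).mul ((hasJet_id.mul hasJet_id).mul (hkj.pow m))).add
      (hasJet_cube_mul (r := fun u => ∑ i ∈ Finset.range m, P.coeff i * u ^ (m - 1 - i) * k u ^ i)
        (by fun_prop)))
    have hj1 : HasJet (fun u => homog P u (k u)) 1 0 0 := by
      refine (hasJet_const 1).congr ?_
      filter_upwards [hmem] with u hu using hk.homog_eq u hu
    obtain ⟨-, e1, e2⟩ := (hj.congr (g := fun u => homog P u (k u))
      (.of_forall fun u => hsplit u (k u))).unique hj1
    rw [hm, show m + 2 - 1 = m + 1 by omega, show m + 2 - 2 = m by omega]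
    push_cast at e1 e2 ⊢
    have hm0 : (m : ℂ) + 2 ≠ 0 := by exact_mod_cast (by omega : m + 2 ≠ 0)
    have hb : P.coeff (m + 1) = -((m + 2) * b) := by linear_combination e1
    have hc : P.coeff m = -((m + 2) * M 0 + (m + 2) * (m + 1) / 2 * b ^ 2 +
        P.coeff (m + 1) * ((m + 1) * b)) := by linear_combination e2
    rw [hc, hb]
    field_simp
    ring
  rw [← hcoef]
  have hdM : ContinuousAt (deriv M) 0 :=
    ((hM.analyticAt hmem).deriv).continuousAt
  refine ⟨fun u => -M u - u * deriv M u, by fun_prop, by simp, ?_⟩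
  filter_upwards [isOpen_starDomain hn0 |>.mem_nhds (zero_mem_starDomain hn0)] with u hu
  have hu' := (isOpen_starDomain hn0).mem_nhds hu
  have h1 : HasDerivAt k (b + (2 * u * M u + u ^ 2 * deriv M u)) u := by
    have h2 : HasDerivAt M (deriv M u) u := (hM.differentiableAt hu').hasDerivAt
    have h3 : HasDerivAt (fun v => 1 + b * v + v ^ 2 * M v)
        (b * 1 + (((2 : ℕ) : ℂ) * u ^ (2 - 1) * M u + u ^ 2 * deriv M u)) u :=
      (((hasDerivAt_id u).const_mul b).const_add 1).add ((hasDerivAt_pow 2 u).mul h2)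
    have h4 := h3.congr_of_eventuallyEq (f₁ := k) (.of_forall hkM)
    exact h4.congr_deriv (by simp)
  rw [hk.speed_eq hP hn0 hu, h1.deriv, hkM u]
  ring

/-- A common value `z` forces `u ^ n = v ^ n`, so `u = c * v` with `c ^ n = 1`. The branch rotated
by `c` then agrees with `k` at `v`, hence at `0`, which gives `c = 1`. -/
theorem injOn_div (hk : IsBranch P k) (hP : P.Monic) (hn : P.natDegree ≠ 0) :
    Set.InjOn (fun u => k u / u) (starDomain P \ {0}) := by
  rintro u ⟨hu, hu0⟩ v ⟨hv, hv0⟩ huv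
  simp only [Set.mem_singleton_iff] at hu0 hv0 huv
  have h1 := hk.homog_eq u hu
  have h2 := hk.homog_eq v hv
  obtain ⟨z, hz⟩ : ∃ z, k v / v = z := ⟨_, rfl⟩
  have hkv : k v = v * z := by rw [← hz]; field_simp
  have hku : k u = u * z := by rw [← hz, ← huv]; field_simp
  rw [hku, homog_mul_right] at h1
  rw [hkv, homog_mul_right] at h2
  have hPz : P.eval z ≠ 0 := by
    intro h
    simp [h] at h1
  have hpow : u ^ P.natDegree = v ^ P.natDegree := mul_right_cancel₀ hPz (h1.trans h2.symm)
  have hc : (u / v) ^ P.natDegree = 1 := by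
    rw [div_pow, hpow, div_self (pow_ne_zero _ hv0)]
  have hc0 : u / v ≠ 0 := div_ne_zero hu0 hv0
  have heq := eqOn_of_branch hP hn (continuousOn_rotate hk.continuousOn hc) hk.continuousOn
    (homog_rotate hk.homog_eq hc0 hc) hk.homog_eq hv
    (by
      rw [div_mul_cancel₀ _ hv0, hku, hkv]
      field_simp) (zero_mem_starDomain hn)
  simp only [mul_zero, hk.map_zero, mul_one, inv_eq_one] at heq
  exact (div_eq_one_iff_eq hv0).mp heq

/-- The branch through `(u₀, u₀ * z)` takes at `0` some `n`-th root of unity as value; rotating by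
it produces `k`. -/
theorem exists_div_eq (hk : IsBranch P k) (hP : P.Monic) (hn : P.natDegree ≠ 0) {u₀ z : ℂ}
    (hu₀ : u₀ ∈ starDomain P) (h : u₀ ^ P.natDegree * P.eval z = 1) :
    ∃ u, u ^ P.natDegree = u₀ ^ P.natDegree ∧ k u / u = z := by
  have hu0 : u₀ ≠ 0 := by
    rintro rfl
    simp [hn] at h
  obtain ⟨q, hq, hq0, hq1⟩ := exists_branch hP hn hu₀ (y₀ := u₀ * z) (by rw [homog_mul_right, h])
  have hc : q 0 ^ P.natDegree = 1 := by
    rw [← homog_zero_left hP, hq1 0 (zero_mem_starDomain hn)]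
  have hc0 : q 0 ≠ 0 := by
    intro h0
    simp [h0, hn] at hc
  have heq := eqOn_of_branch hP hn (continuousOn_rotate hq hc) hk.continuousOn
    (homog_rotate hq1 hc0 hc) hk.homog_eq (zero_mem_starDomain hn)
    (by simp [hk.map_zero, hc0])
  have hc' : (q 0)⁻¹ ^ P.natDegree = 1 := by rw [inv_pow, hc, inv_one]
  have h1 := heq (mul_mem_starDomain hc' hu₀)
  simp only [mul_inv_cancel_left₀ hc0, hq0] at h1
  refine ⟨(q 0)⁻¹ * u₀, by rw [mul_pow, hc', one_mul], ?_⟩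
  rw [← h1]
  field_simp

/-- The parametrization of the lemniscate corresponding to a circle of radius `r`. -/
noncomputable def _root_.Lemniscate.curve (k : ℂ → ℂ) (r θ : ℝ) : ℂ :=
  k (circleMap 0 r θ) / circleMap 0 r θ

theorem hasStrictDerivAt_curve (hk : IsBranch P k) (hP : P.Monic) (hn : P.natDegree ≠ 0)
    {r θ : ℝ} (hr : 0 < r) (hθ : circleMap 0 r θ ∈ starDomain P) :
    HasStrictDerivAt (curve k r)
      (-(speed P k (circleMap 0 r θ) / circleMap 0 r θ * Complex.I)) θ := by
  set u := circleMap 0 r θ with hu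
  have hu0 : u ≠ 0 := circleMap_ne_center hr.ne'
  have h1 : HasStrictDerivAt k (deriv k u) u :=
    ((hk.differentiableOn hP hn).analyticAt ((isOpen_starDomain hn).mem_nhds hθ)).hasStrictDerivAt
  have h2 : HasStrictDerivAt (fun v => k v / v) ((deriv k u * u - k u * 1) / u ^ 2) u :=
    h1.div (hasStrictDerivAt_id u) hu0
  have h3 : HasStrictDerivAt (circleMap 0 r) (u * Complex.I) θ := by
    have := ((contDiff_circleMap 0 r (n := 1)).contDiffAt (x := θ)).hasStrictDerivAt one_ne_zero
    rwa [(hasDerivAt_circleMap 0 r θ).deriv] at this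
  refine (HasStrictDerivAt.scomp θ h2 h3).congr_deriv ?_
  rw [hk.speed_eq hP hn hθ, smul_eq_mul]
  field_simp
  ring

/-- The length of the lemniscate is the integral of the speed, up to the critical level. -/
theorem hausdorffMeasure_eq (hk : IsBranch P k) (hP : P.Monic) (hn : P.natDegree ≠ 0)
    {r : ℝ} (hr : 0 < r)
    (hcrit : ∀ ζ, (derivative P).eval ζ = 0 → r ^ P.natDegree * ‖P.eval ζ‖ ≤ 1) :
    (Measure.hausdorffMeasure 1 {z : ℂ | r ^ P.natDegree * ‖P.eval z‖ = 1}).toReal =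
      2 * Real.pi * r⁻¹ * Real.circleAverage (fun u => ‖speed P k u‖) 0 r := by
  set S := Set.Ioc 0 (2 * Real.pi) \ badAngles P with hS
  have hSm : MeasurableSet S := measurableSet_Ioc.diff (countable_badAngles hn).measurableSet
  have hSmem : ∀ θ ∈ S, circleMap 0 r θ ∈ starDomain P := fun θ hθ =>
    circleMap_mem_starDomain hr.le hcrit hθ.2
  have hinj : Set.InjOn (curve k r) S := by
    intro θ hθ φ hφ h
    have h1 := hk.injOn_div hP hn ⟨hSmem θ hθ, circleMap_ne_center hr.ne'⟩
      ⟨hSmem φ hφ, circleMap_ne_center hr.ne'⟩ h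
    refine injOn_circleMap_of_abs_sub_le (a := 0) (b := 2 * Real.pi) hr.ne' ?_ ?_ ?_ h1
    · rw [zero_sub, abs_neg, abs_of_pos Real.two_pi_pos]
    · rw [Set.uIoc_of_le Real.two_pi_pos.le]; exact hθ.1
    · rw [Set.uIoc_of_le Real.two_pi_pos.le]; exact hφ.1
  have hcont : ContinuousOn (fun θ => speed P k (circleMap 0 r θ)) S :=
    (hk.continuousOn_speed hP hn).comp (continuous_circleMap 0 r).continuousOn hSmem
  have hlen := hausdorffMeasure_image_eq_lintegral (γ := curve k r)
    (γ' := fun θ => -(speed P k (circleMap 0 r θ) / circleMap 0 r θ * Complex.I)) hSm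
    (fun θ hθ => hk.hasStrictDerivAt_curve hP hn hr (hSmem θ hθ))
    (((hcont.div (continuous_circleMap 0 r).continuousOn
      fun θ _ => circleMap_ne_center hr.ne').mul continuousOn_const).neg)
    (fun θ hθ => neg_ne_zero.mpr (mul_ne_zero (div_ne_zero (hk.speed_ne_zero hP hn (hSmem θ hθ))
      (circleMap_ne_center hr.ne')) Complex.I_ne_zero)) hinj
  -- The values of `P` on the lemniscate that correspond to bad angles. They are finitely many, so
  -- their preimage is finite and has no length.
  set W : Set ℂ := (fun ζ => ((r ^ P.natDegree : ℝ) : ℂ)⁻¹ *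
    Complex.exp (Complex.I * (P.eval ζ).arg)) '' {ζ : ℂ | (derivative P).eval ζ = 0} with hW
  have hWfin : {z : ℂ | P.eval z ∈ W}.Finite := by
    refine Set.Finite.preimage' (f := fun z => P.eval z) ((finite_criticalPoints hn).image _)
      fun w _ => ?_
    have h1 : P - C w ≠ 0 := by
      intro h
      have h2 := congrArg natDegree h
      rw [natDegree_sub_C] at h2
      exact hn (by simpa using h2)
    refine ((P - C w).finite_setOfPred_isRoot h1).subset fun z hz => ?_
    simpa [IsRoot, sub_eq_zero] using hz
  have hsub1 : curve k r '' S ⊆ {z : ℂ | r ^ P.natDegree * ‖P.eval z‖ = 1} := by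
    rintro _ ⟨θ, hθ, rfl⟩
    have h1 := hk.homog_eq _ (hSmem θ hθ)
    have h2 : k (circleMap 0 r θ) = circleMap 0 r θ * curve k r θ := by
      rw [curve, mul_div_cancel₀ _ (circleMap_ne_center hr.ne')]
    rw [h2, homog_mul_right] at h1
    have h3 := congrArg norm h1
    rw [norm_mul, norm_pow, norm_circleMap_zero, abs_of_pos hr, norm_one] at h3
    exact h3
  have hsub2 : {z : ℂ | r ^ P.natDegree * ‖P.eval z‖ = 1} ⊆
      curve k r '' S ∪ {z : ℂ | P.eval z ∈ W} := by
    intro z hz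
    simp only [Set.mem_ofPred_eq] at hz
    by_cases hzW : P.eval z ∈ W
    · exact Or.inr hzW
    left
    have hPz : P.eval z ≠ 0 := by
      intro h
      simp [h] at hz
    have hangle : ∀ u : ℂ, u ^ P.natDegree = (P.eval z)⁻¹ → ∃ θ ∈ S, circleMap 0 r θ = u := by
      intro u hu
      have hur : ‖u‖ = r := by
        have h1 := congrArg norm hu
        rw [norm_pow, norm_inv, ← eq_inv_of_mul_eq_one_left hz] at h1
        exact (pow_left_inj₀ (norm_nonneg _) hr.le hn).mp h1
      have h1 : u ∈ Metric.sphere (0 : ℂ) |r| := by simpa [abs_of_pos hr] using hur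
      rw [← image_circleMap_Ioc] at h1
      obtain ⟨θ, hθ, rfl⟩ := h1
      refine ⟨θ, ⟨hθ, ?_⟩, rfl⟩
      rintro ⟨ζ, hζ, he⟩
      apply hzW
      refine ⟨ζ, hζ, ?_⟩
      rw [circleMap_zero, mul_pow, ← Complex.exp_nat_mul] at hu
      have h2 : Complex.exp (P.natDegree * (θ * Complex.I)) *
          Complex.exp (Complex.I * (P.eval ζ).arg) = 1 := by
        rw [← Complex.exp_add, ← he]
        congr 1
        push_cast
        ring
      rw [inv_eq_iff_eq_inv.mp hu.symm, mul_inv, ← eq_inv_of_mul_eq_one_right h2]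
      push_cast
      rfl
    obtain ⟨u₀, hu₀⟩ := IsAlgClosed.exists_pow_nat_eq (P.eval z)⁻¹ (Nat.pos_of_ne_zero hn)
    obtain ⟨θ₀, hθ₀, h0⟩ := hangle u₀ hu₀
    obtain ⟨u, hu, huz⟩ := hk.exists_div_eq hP hn (h0 ▸ hSmem θ₀ hθ₀)
      (by rw [hu₀, inv_mul_cancel₀ hPz])
    obtain ⟨θ, hθ, h1⟩ := hangle u (hu.trans hu₀)
    exact ⟨θ, hθ, by rw [curve, h1, huz]⟩
  have hnull : NullSingletonClass (Measure.hausdorffMeasure 1 : Measure ℂ) :=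
    Measure.nullSingletonClass_hausdorff ℂ one_pos
  have hmeas : Measure.hausdorffMeasure 1 {z : ℂ | r ^ P.natDegree * ‖P.eval z‖ = 1} =
      Measure.hausdorffMeasure 1 (curve k r '' S) := by
    refine le_antisymm ((measure_mono hsub2).trans ((measure_union_le _ _).trans ?_))
      (measure_mono hsub1)
    rw [hWfin.measure_zero, add_zero]
  rw [hmeas, hlen, ← integral_norm_eq_lintegral_enorm]
  · have hae : S =ᵐ[volume] Set.Ioc 0 (2 * Real.pi) :=
      sdiff_null_ae_eq_self ((countable_badAngles hn).measure_zero _)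
    rw [setIntegral_congr_set hae, Real.circleAverage_def,
      intervalIntegral.integral_of_le Real.two_pi_pos.le, smul_eq_mul]
    simp only [norm_neg, norm_mul, norm_div, Complex.norm_I, mul_one, norm_circleMap_zero,
      abs_of_pos hr]
    rw [integral_div]
    field_simp
  · exact ContinuousOn.aestronglyMeasurable ((((hcont.div (continuous_circleMap 0 r).continuousOn
      fun θ _ => circleMap_ne_center hr.ne').mul continuousOn_const).neg)) hSm

theorem tendsto_circleAverage_speed (hk : IsBranch P k) (hP : P.Monic) (hn : 2 ≤ P.natDegree)
    {R : ℝ} (hR : 0 < R)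
    (hcrit : ∀ ζ, (derivative P).eval ζ = 0 → R ^ P.natDegree * ‖P.eval ζ‖ ≤ 1) :
    Tendsto (fun r => Real.circleAverage (fun u => ‖speed P k u‖) 0 r) (𝓝[<] R)
      (𝓝 (Real.circleAverage (fun u => ‖speed P k u‖) 0 R)) := by
  have hn0 : P.natDegree ≠ 0 := by omega
  obtain ⟨C, hC⟩ := exists_norm_inv_homogDeriv_le_majorant hP hn
  have hae : ∀ᵐ θ : ℝ, θ ∉ badAngles P :=
    measure_eq_zero_iff_ae_notMem.mp ((countable_badAngles hn0).measure_zero _)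
  have hcrit' : ∀ r, 0 < r → r ≤ R → ∀ ζ, (derivative P).eval ζ = 0 →
      r ^ P.natDegree * ‖P.eval ζ‖ ≤ 1 := fun r hr hrR ζ hζ =>
    le_trans (by gcongr) (hcrit ζ hζ)
  have hev : ∀ᶠ r in 𝓝[<] R, 0 < r ∧ r ≤ R := by
    filter_upwards [Ioo_mem_nhdsLT hR] with r hr using ⟨hr.1, hr.2.le⟩
  simp only [Real.circleAverage_def]
  refine Tendsto.const_smul ?_ _
  -- The dominating function does not depend on `r`; pointwise convergence holds at every good
  -- angle, where the limit point lies in the open star domain.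
  refine intervalIntegral.tendsto_integral_filter_of_dominated_convergence
    (fun θ => P.natDegree * (C * majorant P θ)) ?_ ?_ ?_ ?_
  · filter_upwards [hev] with r ⟨hr, hrR⟩
    have h1 : ContinuousOn (fun θ => ‖speed P k (circleMap 0 r θ)‖) (badAngles P)ᶜ :=
      ((hk.continuousOn_speed hP hn0).comp (continuous_circleMap 0 r).continuousOn fun θ hθ =>
        circleMap_mem_starDomain hr.le (hcrit' r hr hrR) hθ).norm
    have h2 := h1.aestronglyMeasurable (μ := volume)
      (countable_badAngles hn0).measurableSet.compl
    have h3 : volume.restrict (badAngles P)ᶜ = volume := Measure.restrict_eq_self_of_ae_mem hae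
    rw [h3] at h2
    exact h2.restrict
  · filter_upwards [hev] with r ⟨hr, hrR⟩
    filter_upwards [hae] with θ hθ _
    have hmem := circleMap_mem_starDomain hr.le (hcrit' r hr hrR) hθ
    rw [norm_norm, speed, norm_div, Complex.norm_natCast, div_eq_mul_inv]
    gcongr
    exact hC r θ _ hr (hcrit' r hr hrR) hθ (hk.homog_eq _ hmem)
  · exact ((intervalIntegrable_majorant hn0 _ _).const_mul C).const_mul _
  · filter_upwards [hae] with θ hθ _
    have hmem := circleMap_mem_starDomain hR.le hcrit hθ
    have h1 : ContinuousAt (speed P k) (circleMap 0 R θ) :=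
      (hk.continuousOn_speed hP hn0).continuousAt ((isOpen_starDomain hn0).mem_nhds hmem)
    have h2 : Tendsto (fun r => circleMap 0 r θ) (𝓝[<] R) (𝓝 (circleMap 0 R θ)) := by
      refine Tendsto.mono_left (Continuous.tendsto ?_ R) nhdsWithin_le_nhds
      unfold circleMap
      fun_prop
    exact (h1.tendsto.comp h2).norm

theorem exists_circleAverage_speed_eq (hk : IsBranch P k) (hP : P.Monic) (hn : 2 ≤ P.natDegree)
    {R : ℝ} (hR : 0 < R)
    (hcrit : ∀ ζ, (derivative P).eval ζ = 0 → R ^ P.natDegree * ‖P.eval ζ‖ ≤ 1) :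
    ∃ K : ℂ → ℂ, DifferentiableOn ℂ K (Metric.ball 0 R) ∧
      ‖K 0‖ = ‖(((P.natDegree : ℂ) - 1) * P.coeff (P.natDegree - 1) ^ 2 -
        2 * P.natDegree * P.coeff (P.natDegree - 2)) / (4 * (P.natDegree : ℂ) ^ 2)‖ ∧
      ∀ r : ℝ, 0 ≤ r → r < R → Real.circleAverage (fun u => ‖speed P k u‖) 0 r =
        1 + r ^ 4 * Real.circleAverage (fun u => ‖K u‖ ^ 2) 0 r := by
  have hn0 : P.natDegree ≠ 0 := by omega
  have hsub : Metric.ball 0 R ⊆ starDomain P := fun u hu =>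
    mem_starDomain_of_norm_lt hn0 hcrit (by simpa using hu)
  have hd : DifferentiableOn ℂ (speed P k) (Metric.ball 0 R) := by
    have hkd := (hk.differentiableOn hP hn0).mono hsub
    refine (hkd.sub (differentiableOn_id.mul (hkd.deriv Metric.isOpen_ball))).congr
      fun u hu => hk.speed_eq hP hn0 (hsub hu)
  obtain ⟨K, hK, hK0, hKr⟩ := exists_circleAverage_norm_eq hR hd
    (fun u hu => hk.speed_ne_zero hP hn0 (hsub hu)) (hk.hasJet_speed hP hn)
  refine ⟨K, hK, ?_, hKr⟩
  rw [hK0, neg_div, norm_neg, div_div]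
  congr 2
  ring

/-- `K` lives only on the open disc, so the bound is proved for `r < R` and passed to the limit;
this covers the critical level. -/
theorem one_add_le_circleAverage_speed (hk : IsBranch P k) (hP : P.Monic) (hn : 2 ≤ P.natDegree)
    {R : ℝ} (hR : 0 < R)
    (hcrit : ∀ ζ, (derivative P).eval ζ = 0 → R ^ P.natDegree * ‖P.eval ζ‖ ≤ 1) :
    1 + R ^ 4 * ‖(((P.natDegree : ℂ) - 1) * P.coeff (P.natDegree - 1) ^ 2 -
        2 * P.natDegree * P.coeff (P.natDegree - 2)) / (4 * (P.natDegree : ℂ) ^ 2)‖ ^ 2 ≤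
      Real.circleAverage (fun u => ‖speed P k u‖) 0 R := by
  obtain ⟨K, hK, hK0, hKr⟩ := hk.exists_circleAverage_speed_eq hP hn hR hcrit
  rw [← hK0]
  have h1 : Tendsto (fun r : ℝ => 1 + r ^ 4 * ‖K 0‖ ^ 2) (𝓝[<] R) (𝓝 (1 + R ^ 4 * ‖K 0‖ ^ 2)) :=
    Tendsto.mono_left (Continuous.tendsto (by fun_prop) R) nhdsWithin_le_nhds
  refine le_of_tendsto_of_tendsto h1 (hk.tendsto_circleAverage_speed hP hn hR hcrit) ?_
  filter_upwards [Ioo_mem_nhdsLT hR] with r hr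
  rw [hKr r hr.1.le hr.2]
  gcongr
  exact sq_norm_center_le_circleAverage hr.1.le hr.2 hK

end IsBranch

/-! ### Logarithmic levels and the radius `exp (-t / n)` -/

theorem logAbs_eq_iff {P : ℂ[X]} {z : ℂ} {t : ℝ} :
    logAbs P z = (t : EReal) ↔ ‖P.eval z‖ = Real.exp t := by
  have h1 : (t : EReal) = ENNReal.log (ENNReal.ofReal (Real.exp t)) := by
    rw [ENNReal.log_ofReal_of_pos (Real.exp_pos t), Real.log_exp]
  rw [logAbs, h1, ENNReal.log_eq_iff, ← ofReal_norm,
    ENNReal.ofReal_eq_ofReal_iff (norm_nonneg _) (Real.exp_pos t).le]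

theorem logAbs_le_iff {P : ℂ[X]} {z : ℂ} {t : ℝ} :
    logAbs P z ≤ (t : EReal) ↔ ‖P.eval z‖ ≤ Real.exp t := by
  have h1 : (t : EReal) = ENNReal.log (ENNReal.ofReal (Real.exp t)) := by
    rw [ENNReal.log_ofReal_of_pos (Real.exp_pos t), Real.log_exp]
  rw [logAbs, h1, ENNReal.log_le_log_iff, ← ofReal_norm,
    ENNReal.ofReal_le_ofReal_iff (Real.exp_pos t).le]

theorem maxCriticalValue_le_iff {P : ℂ[X]} {t : ℝ} :
    maxCriticalValue P ≤ (t : EReal) ↔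
      ∀ ζ, (derivative P).eval ζ = 0 → ‖P.eval ζ‖ ≤ Real.exp t := by
  simp [maxCriticalValue, iSup_le_iff, logAbs_le_iff]

theorem exp_neg_div_pow {n : ℕ} (hn : n ≠ 0) (t : ℝ) :
    Real.exp (-t / n) ^ n = (Real.exp t)⁻¹ := by
  have : (n : ℝ) ≠ 0 := by exact_mod_cast hn
  rw [← Real.exp_nat_mul, mul_div_cancel₀ _ this, Real.exp_neg]

theorem exp_pow_mul_le_one {P : ℂ[X]} (hn : P.natDegree ≠ 0) {t : ℝ}
    (ht : maxCriticalValue P ≤ (t : EReal)) :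
    ∀ ζ, (derivative P).eval ζ = 0 →
      Real.exp (-t / P.natDegree) ^ P.natDegree * ‖P.eval ζ‖ ≤ 1 := by
  intro ζ hζ
  rw [exp_neg_div_pow hn, inv_mul_le_one₀ (Real.exp_pos t)]
  exact maxCriticalValue_le_iff.mp ht ζ hζ

theorem eventually_maxCriticalValue_le {P : ℂ[X]} (hn : P.natDegree ≠ 0) :
    ∀ᶠ t : ℝ in atTop, maxCriticalValue P ≤ (t : EReal) := by
  simp only [maxCriticalValue_le_iff]
  exact (Set.Finite.eventually_all (finite_criticalPoints hn)).mpr fun ζ _ =>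
    Real.tendsto_exp_atTop.eventually_ge_atTop _

/-- The normalized length of a lemniscate above the critical levels is a mean of the speed. -/
theorem IsBranch.length_eq {P : ℂ[X]} {k : ℂ → ℂ} (hk : IsBranch P k) (hP : P.Monic)
    (hn : P.natDegree ≠ 0) {t : ℝ} (ht : maxCriticalValue P ≤ (t : EReal)) :
    Real.exp (-t / P.natDegree) / (2 * Real.pi) * length P t =
      Real.circleAverage (fun u => ‖speed P k u‖) 0 (Real.exp (-t / P.natDegree)) := by
  have h1 : level P t =
      {z : ℂ | Real.exp (-t / P.natDegree) ^ P.natDegree * ‖P.eval z‖ = 1} := by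
    ext z
    rw [level, Set.mem_ofPred_eq, Set.mem_ofPred_eq, logAbs_eq_iff, exp_neg_div_pow hn,
      inv_mul_eq_one₀ (Real.exp_pos t).ne', eq_comm]
  rw [length, h1, hk.hausdorffMeasure_eq hP hn (Real.exp_pos _) (exp_pow_mul_le_one hn ht)]
  have := Real.exp_pos (-t / P.natDegree)
  have := Real.pi_pos
  field_simp

end Lemniscate

open Lemniscate in
theorem mainTheorem11 (n : ℕ) (hn : 2 ≤ n) (P : ℂ[X]) (hP : P.Monic) (hdeg : P.natDegree = n)
    (a₁ a₂ : ℂ) (ha₁ : a₁ = P.coeff (n - 1)) (ha₂ : a₂ = P.coeff (n - 2)) :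
    (∀ t : ℝ, Lemniscate.maxCriticalValue P ≤ (t : EReal) →
      Real.exp (4 * t / n) * (Real.exp (-t / n) / (2 * Real.pi) * Lemniscate.length P t - 1) ≥
        ‖(((n : ℂ) - 1) * a₁ ^ 2 - 2 * (n : ℂ) * a₂) / (4 * (n : ℂ) ^ 2)‖ ^ 2) ∧
    Tendsto
      (fun t : ℝ =>
        Real.exp (4 * t / n) * (Real.exp (-t / n) / (2 * Real.pi) * Lemniscate.length P t - 1))
      atTop
      (𝓝 (‖(((n : ℂ) - 1) * a₁ ^ 2 - 2 * (n : ℂ) * a₂) / (4 * (n : ℂ) ^ 2)‖ ^ 2)) := by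
  subst hdeg ha₁ ha₂
  have hn0 : P.natDegree ≠ 0 := by omega
  obtain ⟨k, hk⟩ := exists_isBranch hP hn0
  have hexp : ∀ t : ℝ, Real.exp (4 * t / P.natDegree) * Real.exp (-t / P.natDegree) ^ 4 = 1 := by
    intro t
    rw [← Real.exp_nat_mul, ← Real.exp_add, Real.exp_eq_one_iff]
    push_cast
    ring
  constructor
  · intro t ht
    rw [hk.length_eq hP hn0 ht]
    have h := hk.one_add_le_circleAverage_speed hP hn (Real.exp_pos _) (exp_pow_mul_le_one hn0 ht)
    have h1 := mul_le_mul_of_nonneg_left (le_sub_iff_add_le'.mpr h)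
      (Real.exp_pos (4 * t / P.natDegree)).le
    rwa [← mul_assoc, hexp, one_mul] at h1
  -- Any admissible level `t₀` fixes one disc and one `K`, valid for all `t > t₀`.
  · obtain ⟨t₀, ht₀⟩ := (eventually_maxCriticalValue_le hn0).exists
    obtain ⟨K, hK, hK0, hKr⟩ := hk.exists_circleAverage_speed_eq hP hn (Real.exp_pos _)
      (exp_pow_mul_le_one hn0 ht₀)
    rw [← hK0]
    have hpos : (0 : ℝ) < P.natDegree := by exact_mod_cast Nat.pos_of_ne_zero hn0
    have hlim : Tendsto (fun t : ℝ => Real.exp (-t / P.natDegree)) atTop (𝓝[>] 0) := by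
      refine tendsto_nhdsWithin_iff.mpr ⟨?_, .of_forall fun t => Real.exp_pos _⟩
      refine Real.tendsto_exp_atBot.comp ?_
      simp_rw [neg_div]
      exact tendsto_neg_atTop_atBot.comp (tendsto_id.atTop_div_const hpos)
    refine ((tendsto_circleAverage_sq_norm (Real.exp_pos _) hK).comp hlim).congr' ?_
    filter_upwards [eventually_maxCriticalValue_le hn0, eventually_gt_atTop t₀] with t ht htt
    have hlt : Real.exp (-t / P.natDegree) < Real.exp (-t₀ / P.natDegree) := by
      gcongr
    rw [hk.length_eq hP hn0 ht, hKr _ (Real.exp_pos _).le hlt, add_sub_cancel_left, ← mul_assoc,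
      hexp, one_mul, Function.comp_apply]
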